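/- Let $q$ be an indeterminate. For $x,b\in\mathbb{Q}(q)$ and an integer $k\ge 0$ put $(x;b)_k=\prod_{i=0}^{k-1}(1-xb^i)$, let $[r]=(1-q^r)/(1-q)$ denote the $q$-integer, and let $\Phi_n(q)$ be the $n$-th cyclotomic polynomial in $q$. For rational functions $A,B\in\mathbb{Q}(q)$ and a polynomial $P\in\mathbb{Q}[q]$, write $A\equiv B\pmod{P}$ if $P$ divides the numerator of $A-B$ written in lowest terms. Let $n$ be a positive odd integer and, for $k\ge 0$, let $$\theta_q(k)=[4k+1]\frac{(q;q^2)_k^6}{(q^2;q^2)_k^6}\,q^k .$$ Then, modulo $[n]\Phi_n(q)^5$, $$\sum_{\substack{i,j\ge 0\\ i+j\le n-1}}\theta_q(i)\theta_q(j)\equiv [n]^2q^{1-n}\left(\sum_{k=0}^{(n-1)/2}\frac{(q;q^2)_k^4}{(q^2;q^2)_k^4}q^{2k}\right)\left(\sum_{k=0}^{(n-1)/2}\frac{(q;q^2)_k^4}{(q^2;q^2)_k^4}q^{2k}\left\{1-2(2-q^n)[n]^2\sum_{t=1}^{2k}\frac{q^t}{[t]^2}\right\}\right).$$ -/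

import Mathlib

open Polynomial

noncomputable section

namespace QSuper

/-- The indeterminate `q` as an element of the field of rational functions `ℚ(q)`. -/
def q : RatFunc ℚ := RatFunc.X

/-- The `q`-shifted factorial `(x; b)_k = (1 - x) (1 - x b) ⋯ (1 - x b ^ (k - 1))`. -/
def qPoch (x b : RatFunc ℚ) (k : ℕ) : RatFunc ℚ :=
  ∏ i ∈ Finset.range k, (1 - x * b ^ i)

/-- The `q`-integer `[r] = (1 - q ^ r) / (1 - q)`. -/
def qInt (r : ℕ) : RatFunc ℚ := (1 - q ^ r) / (1 - q)

/-- The `q`-integer as a polynomial, `1 + q + ⋯ + q ^ (r - 1)`. -/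
def qIntPoly (r : ℕ) : ℚ[X] := ∑ i ∈ Finset.range r, (X : ℚ[X]) ^ i

theorem one_sub_q_ne_zero : (1 - q : RatFunc ℚ) ≠ 0 := by
  have h : (1 - q : RatFunc ℚ) = algebraMap ℚ[X] (RatFunc ℚ) (1 - X) := by
    simp [q, RatFunc.algebraMap_X]
  rw [h]
  refine RatFunc.algebraMap_ne_zero ?_
  intro h0
  have h1 := congrArg (Polynomial.eval 0) h0
  simp at h1

/-- The two forms of the `q`-integer agree. -/
theorem algebraMap_qIntPoly (r : ℕ) :
    algebraMap ℚ[X] (RatFunc ℚ) (qIntPoly r) = qInt r := by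
  rw [qInt, eq_div_iff one_sub_q_ne_zero]
  simp only [qIntPoly, map_sum, map_pow, RatFunc.algebraMap_X, q]
  exact geom_sum_mul_neg _ _

/-- Congruence of rational functions modulo a polynomial `P`: the numerator of `A - B`, written in
lowest terms, is divisible by `P`. -/
def RatModEq (P : ℚ[X]) (A B : RatFunc ℚ) : Prop := P ∣ (A - B).num

/-- `θ_q(k) = [4k+1] (q;q²)_k⁶ / (q²;q²)_k⁶ q^k`. -/
def theta (k : ℕ) : RatFunc ℚ :=
  qInt (4 * k + 1) * (qPoch q (q ^ 2) k ^ 6 / qPoch (q ^ 2) (q ^ 2) k ^ 6) * q ^ k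

/-- `(q;q²)_k⁴ / (q²;q²)_k⁴ q^{2k}`. -/
def term (k : ℕ) : RatFunc ℚ :=
  qPoch q (q ^ 2) k ^ 4 / qPoch (q ^ 2) (q ^ 2) k ^ 4 * q ^ (2 * k)

end QSuper

end

/-! Write n = 2m+1. Since [n] is the product of Φ_d over the divisors d ≠ 1 of n, the modulus is
Φ_n^6 times the Φ_d with d ≠ 1, n (`modulus_dvd`). These factors are pairwise coprime and are
treated one at a time, by looking at values and orders of vanishing at a primitive d-th root of
unity ζ.

For every d ≠ 1 both sides vanish at ζ (`cyclotomic_dvd_num`). On the right this is the factor [n].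
On the left, θ takes values on residue blocks mod d that are proportional to a fixed pattern, and
this pattern has sum zero because it is antisymmetric under k ↦ (d-1)/2 - k.

For Φ_n^6, θ(k) has order 6 for m < k < n, so the double sum is S² with S = Σ_{k≤m} θ(k)
(`ordGE_doubleSum_sub_sq`). It remains to know S modulo Φ_n^5, because S itself has order 1. Put X₀
= q^n + q^(-n) - 2, of order 2, and deform two of the squared factors of the summand,
(q;q²)_k²/(q²;q²)_k² each, through w = 2 or w = 2 + X₀. If R_k is the ratio of deformed to
undeformed factor, then 1 = 2R_k - R_k² + (R_k - 1)². The terms 2R_k and R_k² give sums that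
terminate and are evaluated by `terminating_watson`. The term (R_k - 1)² is X₀² times a
reflection-invariant weight to leading order, so antisymmetry supplies the fifth factor Φ_n
(`ordGE_second_difference`). Expanding Watson's right side to first order in X₀ produces the sum
over q^t/[t]² (`ordGE_combination`), and squaring finishes (`ordGE_difference`). -/

namespace QSuper

/-! ### Telescoping identities over an arbitrary field -/

section ExactIdentities

variable {F : Type*} [Field F]

/-- The factor `1 + x ^ (2s) - x ^ s w`, that is `(1 - x ^ s y) (1 - x ^ s / y)` for
`w = y + 1 / y`. -/
def pairFactor (x w : F) (s : ℕ) : F := 1 + x ^ (2 * s) - x ^ s * w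

/-- The product of the factors `pairFactor` of odd index. -/
def oddProd (x w : F) (k : ℕ) : F := ∏ i ∈ Finset.range k, pairFactor x w (2 * i + 1)

/-- The product of the factors `pairFactor` of even index. -/
def evenProd (x w : F) (k : ℕ) : F := ∏ i ∈ Finset.range k, pairFactor x w (2 * i + 2)

/-- The quotient of `oddProd` by `evenProd`. -/
def pairRatio (x w : F) (k : ℕ) : F :=
  ∏ i ∈ Finset.range k, pairFactor x w (2 * i + 1) / pairFactor x w (2 * i + 2)

/-- `(x;x²)_k / (x²;x²)_k`. -/
def beta (x : F) (k : ℕ) : F :=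
  ∏ i ∈ Finset.range k, (1 - x ^ (2 * i + 1)) / (1 - x ^ (2 * i + 2))

/-- `(1/K;x²)_j (xK;x²)_j`. -/
def wellPoised (x K : F) (j : ℕ) : F :=
  ∏ i ∈ Finset.range j, (1 - x ^ (2 * i) / K) * (1 - x * K * x ^ (2 * i))

theorem pairRatio_eq_div (x w : F) (k : ℕ) :
    pairRatio x w k = oddProd x w k / evenProd x w k := by
  simp [pairRatio, oddProd, evenProd, Finset.prod_div_distrib]

theorem pairFactor_two (x : F) (s : ℕ) : pairFactor x 2 s = (1 - x ^ s) ^ 2 := by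
  unfold pairFactor; ring

theorem pairFactor_add_inv {x : F} (hx0 : x ≠ 0) (n s : ℕ) :
    pairFactor x (x ^ n + (x ^ n)⁻¹) s = (1 - x ^ s * x ^ n) * (1 - x ^ s / x ^ n) := by
  unfold pairFactor
  field_simp
  ring

theorem one_sub_ne {x : F} (hx : ∀ k, x ^ (k + 1) ≠ 1) (k : ℕ) : 1 - x ^ (k + 1) ≠ 0 :=
  fun h => hx k (sub_eq_zero.mp h).symm

theorem evenProd_ne_zero {x w : F} {k : ℕ} (h : ∀ i < k, pairFactor x w (2 * i + 2) ≠ 0) :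
    evenProd x w k ≠ 0 :=
  Finset.prod_ne_zero_iff.mpr fun i hi => h i (Finset.mem_range.mp hi)

/-- Replacing K by x²K shifts both q-factorials by one place, so only their end factors change. The
relation is cleared of denominators. -/
theorem wellPoised_shift {x K : F} (hx0 : x ≠ 0) (hK : K ≠ 0) (j : ℕ) :
    wellPoised x (x ^ 2 * K) j * (x ^ (2 * j) - x ^ 2 * K) * (1 - x * K) =
      (1 - x ^ 2 * K) * wellPoised x K j * (1 - x * K * x ^ (2 * j)) := by
  induction j with
  | zero => simp [wellPoised]
  | succ j ih =>
    have e1 : wellPoised x (x ^ 2 * K) (j + 1) = wellPoised x (x ^ 2 * K) j *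
        ((1 - x ^ (2 * j) / (x ^ 2 * K)) * (1 - x * (x ^ 2 * K) * x ^ (2 * j))) :=
      Finset.prod_range_succ _ _
    have e2 : wellPoised x K (j + 1) = wellPoised x K j *
        ((1 - x ^ (2 * j) / K) * (1 - x * K * x ^ (2 * j))) :=
      Finset.prod_range_succ _ _
    have e3 : x ^ (2 * (j + 1)) = x ^ 2 * x ^ (2 * j) := by ring
    rw [e1, e2, e3]
    generalize x ^ (2 * j) = J at *
    have e4 : (1 - J / (x ^ 2 * K)) * (x ^ 2 * J - x ^ 2 * K) =
        (J - x ^ 2 * K) * (1 - J / K) := by field_simp; ring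
    linear_combination (wellPoised x (x ^ 2 * K) j * (1 - x * K) *
      (1 - x * (x ^ 2 * K) * J)) * e4 + (1 - J / K) * (1 - x * (x ^ 2 * K) * J) * ih

theorem wellPoised_eq_zero {x : F} (hx0 : x ≠ 0) {k j : ℕ} (h : k < j) :
    wellPoised x (x ^ (2 * k)) j = 0 := by
  refine Finset.prod_eq_zero (Finset.mem_range.mpr h) ?_
  rw [div_self (pow_ne_zero _ hx0)]; simp

/-- Creative telescoping in j: the right side is the certificate. For K = x^(2k) and M > k + 1 it
vanishes, which leaves a first-order recurrence in k for the sum in `pow_mul_pairRatio`. -/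
theorem sum_expansion_step {x w K : F} (hx : ∀ k, x ^ (k + 1) ≠ 1) (hx0 : x ≠ 0) (hK : K ≠ 0)
    (M : ℕ) (hw : ∀ i < M, pairFactor x w (2 * i + 2) ≠ 0) :
    ∑ j ∈ Finset.range M, ((1 + x ^ 4 * K ^ 2 - x ^ 2 * K * w) * wellPoised x (x ^ 2 * K) j -
        x * (1 + x ^ 2 * K ^ 2 - x * K * w) * wellPoised x K j) * beta x j * x ^ (2 * j) /
          evenProd x w j =
      -(K * x ^ 2) * (wellPoised x (x ^ 2 * K) M - wellPoised x K M) * beta x M *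
        pairFactor x w (2 * M) / evenProd x w M := by
  induction M with
  | zero => simp [wellPoised]
  | succ M ih =>
    rw [Finset.sum_range_succ, ih fun i hi => hw i (by omega)]
    have hs := wellPoised_shift (K := K) hx0 hK M
    have e1 : wellPoised x (x ^ 2 * K) (M + 1) = wellPoised x (x ^ 2 * K) M *
        ((1 - x ^ (2 * M) / (x ^ 2 * K)) * (1 - x * (x ^ 2 * K) * x ^ (2 * M))) :=
      Finset.prod_range_succ _ _
    have e2 : wellPoised x K (M + 1) = wellPoised x K M *
        ((1 - x ^ (2 * M) / K) * (1 - x * K * x ^ (2 * M))) :=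
      Finset.prod_range_succ _ _
    have e3 : evenProd x w (M + 1) = evenProd x w M * pairFactor x w (2 * (M + 1)) :=
      Finset.prod_range_succ _ _
    have e4 : beta x (M + 1) = beta x M *
        ((1 - x ^ (2 * M + 1)) / (1 - x ^ (2 * M + 2))) :=
      Finset.prod_range_succ _ _
    have h1 : pairFactor x w (2 * (M + 1)) ≠ 0 := hw M (by omega)
    have h2 : evenProd x w M ≠ 0 := evenProd_ne_zero fun i hi => hw i (by omega)
    have h3 : 1 - x ^ 2 * x ^ (2 * M) ≠ 0 := by
      rw [← pow_add, add_comm]; exact one_sub_ne hx _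
    rw [e1, e2, e3, e4, mul_div_mul_right _ _ h1]
    have e5 : pairFactor x w (2 * M) = 1 + (x ^ (2 * M)) ^ 2 - x ^ (2 * M) * w := by
      unfold pairFactor; ring
    have e6 : x ^ (2 * M + 1) = x * x ^ (2 * M) := by ring
    have e7 : x ^ (2 * M + 2) = x ^ 2 * x ^ (2 * M) := by ring
    rw [e5, e6, e7]
    have hJ : x ^ (2 * M) ≠ 0 := pow_ne_zero _ hx0
    generalize x ^ (2 * M) = J at *
    generalize wellPoised x (x ^ 2 * K) M = a at *
    generalize wellPoised x K M = b at *
    field_simp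
    linear_combination (x * J * (1 - x) * beta x M) * hs

/-- A case of the q-Saalschütz summation in base x². Both sides satisfy the same first-order
recurrence in k and agree at k = 0. The range N is independent of k, so that the order of summation
can be exchanged later. -/
theorem pow_mul_pairRatio {x w : F} (hx : ∀ k, x ^ (k + 1) ≠ 1) (hx0 : x ≠ 0) (N k : ℕ)
    (hk : k < N) (hw : ∀ i < N, pairFactor x w (2 * i + 2) ≠ 0) :
    x ^ k * pairRatio x w k = ∑ j ∈ Finset.range N,
      wellPoised x (x ^ (2 * k)) j * beta x j * x ^ (2 * j) / evenProd x w j := by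
  induction k with
  | zero =>
    rw [Finset.sum_eq_single_of_mem 0 (Finset.mem_range.mpr hk)]
    · simp [pairRatio, wellPoised, beta, evenProd]
    · intro j _ hj
      rw [wellPoised_eq_zero hx0 (by omega)]; simp
  | succ k ih =>
    have hs := sum_expansion_step (w := w) (K := x ^ (2 * k)) hx hx0 (pow_ne_zero _ hx0) N hw
    have e0 : x ^ 2 * x ^ (2 * k) = x ^ (2 * (k + 1)) := by ring
    rw [e0, wellPoised_eq_zero hx0 hk, wellPoised_eq_zero hx0 (by omega : k < N)] at hs
    have e1 : pairRatio x w (k + 1) = pairRatio x w k *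
        (pairFactor x w (2 * k + 1) / pairFactor x w (2 * k + 2)) :=
      Finset.prod_range_succ _ _
    have h1 := hw k (by omega)
    have ih := ih (by omega)
    have e2 : 1 + x ^ 4 * (x ^ (2 * k)) ^ 2 - x ^ (2 * (k + 1)) * w =
      pairFactor x w (2 * k + 2) := by unfold pairFactor; ring
    have e3 : 1 + x ^ 2 * (x ^ (2 * k)) ^ 2 - x * x ^ (2 * k) * w =
      pairFactor x w (2 * k + 1) := by unfold pairFactor; ring
    rw [e2, e3] at hs
    have e4 : ∑ j ∈ Finset.range N, (pairFactor x w (2 * k + 2) *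
        wellPoised x (x ^ (2 * (k + 1))) j - x * pairFactor x w (2 * k + 1) *
          wellPoised x (x ^ (2 * k)) j) * beta x j * x ^ (2 * j) / evenProd x w j =
        pairFactor x w (2 * k + 2) * (∑ j ∈ Finset.range N,
          wellPoised x (x ^ (2 * (k + 1))) j * beta x j * x ^ (2 * j) / evenProd x w j) -
        x * pairFactor x w (2 * k + 1) * ∑ j ∈ Finset.range N,
          wellPoised x (x ^ (2 * k)) j * beta x j * x ^ (2 * j) / evenProd x w j := by
      rw [Finset.mul_sum, Finset.mul_sum, ← Finset.sum_sub_distrib]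
      exact Finset.sum_congr rfl fun j _ => by ring
    rw [e4, ← ih] at hs
    apply mul_left_cancel₀ h1
    rw [e1, pow_succ]
    field_simp
    linear_combination -hs

/-- Telescoping in k, which relates the very-well-poised sums for j and j + 1 up to a boundary term
at M. -/
theorem sum_wellPoised_step {x w : F} (hx : ∀ k, x ^ (k + 1) ≠ 1) (hx0 : x ≠ 0) (j M : ℕ)
    (hw : ∀ i < M, pairFactor x w (2 * i + 2) ≠ 0) :
    ∑ k ∈ Finset.range M, (1 - x ^ (4 * k + 1)) * (pairRatio x w k * beta x k ^ 2 *
        (pairFactor x w (2 * j + 1) * (1 - x ^ (2 * j + 1)) / (1 - x ^ (2 * j + 2)) *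
          wellPoised x (x ^ (2 * k)) j - wellPoised x (x ^ (2 * k)) (j + 1))) =
      x ^ (2 * j) * x ^ 2 / (1 - x ^ (2 * j + 2)) * (pairRatio x w M * beta x M ^ 2 *
        wellPoised x (x ^ (2 * M)) j) * pairFactor x w (2 * M) * (1 - x ^ (2 * M)) *
          (x ^ (2 * j) - x ^ (2 * M)) / x ^ (2 * M) := by
  induction M with
  | zero => simp
  | succ k ih =>
    rw [Finset.sum_range_succ, ih fun i hi => hw i (by omega)]
    have hs := wellPoised_shift (x := x) (K := x ^ (2 * k)) hx0 (pow_ne_zero _ hx0) j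
    have e0 : x ^ (2 * (k + 1)) = x ^ 2 * x ^ (2 * k) := by ring
    have e1 : pairRatio x w (k + 1) = pairRatio x w k *
        (pairFactor x w (2 * k + 1) / pairFactor x w (2 * (k + 1))) :=
      Finset.prod_range_succ _ _
    have e2 : wellPoised x (x ^ (2 * k)) (j + 1) = wellPoised x (x ^ (2 * k)) j *
        ((1 - x ^ (2 * j) / x ^ (2 * k)) * (1 - x * x ^ (2 * k) * x ^ (2 * j))) :=
      Finset.prod_range_succ _ _
    have e4 : beta x (k + 1) = beta x k *
        ((1 - x ^ (2 * k + 1)) / (1 - x ^ (2 * k + 2))) :=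
      Finset.prod_range_succ _ _
    have h1 : pairFactor x w (2 * (k + 1)) ≠ 0 := hw k (by omega)
    have h3 : 1 - x ^ 2 * x ^ (2 * k) ≠ 0 := by
      rw [← pow_add, add_comm]; exact one_sub_ne hx _
    have h4 : 1 - x ^ 2 * x ^ (2 * j) ≠ 0 := by
      rw [← pow_add, add_comm]; exact one_sub_ne hx _
    have h5 : 1 - x * x ^ (2 * k) ≠ 0 := by
      rw [← pow_succ']; exact one_sub_ne hx _
    rw [e1, e2, e4, e0]
    have d1 (s : ℕ) : pairFactor x w (2 * s) = 1 + (x ^ (2 * s)) ^ 2 - x ^ (2 * s) * w := by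
      unfold pairFactor; ring
    have d2 (s : ℕ) : pairFactor x w (2 * s + 1) =
        1 + x ^ 2 * (x ^ (2 * s)) ^ 2 - x * x ^ (2 * s) * w := by
      unfold pairFactor; ring
    have e6 (s : ℕ) : x ^ (2 * s + 1) = x * x ^ (2 * s) := by ring
    have e7 (s : ℕ) : x ^ (2 * s + 2) = x ^ 2 * x ^ (2 * s) := by ring
    have e8 : x ^ (4 * k + 1) = x * (x ^ (2 * k)) ^ 2 := by ring
    -- Cancels the common factor f and isolates the product to which the shift relation `hs`
    -- applies.
    have e10 : ∀ (A B p f b a u : F), f ≠ 0 →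
      A * (p * (B / f) * (b * ((1 - x * x ^ (2 * k)) / (1 - x ^ 2 * x ^ (2 * k)))) ^ 2 * a) * f *
        (1 - x ^ 2 * x ^ (2 * k)) * (x ^ (2 * j) - x ^ 2 * x ^ (2 * k)) / u =
      A * p * B * b ^ 2 * (1 - x * x ^ (2 * k)) *
        (a * (x ^ (2 * j) - x ^ 2 * x ^ (2 * k)) * (1 - x * x ^ (2 * k))) /
          (1 - x ^ 2 * x ^ (2 * k)) / u := by
      intro A B p f b a u hf
      field_simp
    rw [e6, e6, e7, e7, e8, e10 _ _ _ _ _ _ _ h1, hs, d1, d2, d2]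
    have hJ : x ^ (2 * j) ≠ 0 := pow_ne_zero _ hx0
    have hK : x ^ (2 * k) ≠ 0 := pow_ne_zero _ hx0
    generalize x ^ (2 * j) = J at *
    generalize x ^ (2 * k) = K at *
    generalize hD : 1 - x ^ 2 * J = D at *
    field_simp
    rw [← hD]
    ring

end ExactIdentities

/-! ### Watson's transformation in the terminating case -/

section TransformationFormula

variable {F : Type*} [Field F]

theorem pairFactor_root_zero {x : F} (hx0 : x ≠ 0) (n : ℕ) :
    pairFactor x (x ^ n + (x ^ n)⁻¹) n = 0 := by
  rw [pairFactor_add_inv hx0, div_self (pow_ne_zero _ hx0)]; simp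

theorem pairFactor_root_ne_zero {x : F} (hx : ∀ k, x ^ (k + 1) ≠ 1) (hx0 : x ≠ 0) {n s : ℕ}
    (hs : 0 < s) (hns : n ≠ s) : pairFactor x (x ^ n + (x ^ n)⁻¹) s ≠ 0 := by
  rw [pairFactor_add_inv hx0]
  refine mul_ne_zero ?_ ?_
  · obtain ⟨t, rfl⟩ := Nat.exists_eq_succ_of_ne_zero hs.ne'
    rw [← pow_add, Nat.succ_eq_add_one, show t + 1 + n = t + n + 1 by ring]
    exact one_sub_ne hx _
  · intro h
    rw [sub_eq_zero, eq_comm, div_eq_one_iff_eq (pow_ne_zero _ hx0)] at h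
    rcases lt_or_gt_of_ne hns with h1 | h1
    · obtain ⟨t, rfl⟩ := Nat.exists_eq_add_of_lt h1
      rw [add_assoc, pow_add] at h
      exact hx t (mul_left_cancel₀ (pow_ne_zero n hx0) (by rw [h, mul_one]))
    · obtain ⟨t, rfl⟩ := Nat.exists_eq_add_of_lt h1
      rw [add_assoc, pow_add] at h
      exact hx t (mul_left_cancel₀ (pow_ne_zero s hx0) (by rw [← h, mul_one]))

theorem pairFactor_root_even_ne_zero {x : F} (hx : ∀ k, x ^ (k + 1) ≠ 1) (hx0 : x ≠ 0)
    (m i : ℕ) : pairFactor x (x ^ (2 * m + 1) + (x ^ (2 * m + 1))⁻¹) (2 * i + 2) ≠ 0 :=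
  pairFactor_root_ne_zero hx hx0 (by omega) (by omega)

theorem pairFactor_two_ne_zero {x : F} (hx : ∀ k, x ^ (k + 1) ≠ 1) (i : ℕ) :
    pairFactor x 2 (2 * i + 2) ≠ 0 := by
  rw [pairFactor_two]; exact pow_ne_zero _ (one_sub_ne hx _)

/-- After reversing both outer products the identity holds factor by factor: each side contributes 1
- x^(-2i-1). -/
theorem prod_reflected_eq {x : F} (hx : ∀ k, x ^ (k + 1) ≠ 1) (hx0 : x ≠ 0) (m : ℕ) :
    (∏ i ∈ Finset.range m, (1 - x ^ (2 * i) / x ^ (2 * m))) * beta x m * x ^ m =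
      ∏ i ∈ Finset.range m, (1 - x ^ (2 * i + 2) / x ^ (2 * m + 1)) := by
  rw [← Finset.prod_range_reflect, ← Finset.prod_range_reflect
    (fun i => 1 - x ^ (2 * i + 2) / x ^ (2 * m + 1)), beta, ← Finset.prod_mul_distrib]
  have : x ^ m = ∏ i ∈ Finset.range m, x := by simp
  rw [this, ← Finset.prod_mul_distrib]
  refine Finset.prod_congr rfl fun i hi => ?_
  have hi := Finset.mem_range.mp hi
  obtain ⟨t, rfl⟩ := Nat.exists_eq_add_of_lt hi
  have e1 : i + t + 1 - 1 - i = t := by omega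
  rw [e1]
  have h1 := one_sub_ne hx (2 * i + 1)
  have e2 : x ^ (2 * (i + t + 1)) = x ^ (2 * t) * (x ^ (2 * i) * x ^ 2) := by ring
  have e3 : x ^ (2 * (i + t + 1) + 1) = x ^ (2 * t) * (x ^ (2 * i) * x ^ 3) := by ring
  have e4 : x ^ (2 * t + 2) = x ^ (2 * t) * x ^ 2 := by ring
  have e5 : x ^ (2 * i + 1) = x ^ (2 * i) * x := by ring
  have e6 : x ^ (2 * i + 2) = x ^ (2 * i) * x ^ 2 := by ring
  have h1 : 1 - x ^ (2 * i) * x ^ 2 ≠ 0 := by rw [← e6]; exact h1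
  rw [e2, e3, e4, e5, e6]
  have h2 : x ^ (2 * t) ≠ 0 := pow_ne_zero _ hx0
  have h3 : x ^ (2 * i) ≠ 0 := pow_ne_zero _ hx0
  generalize x ^ (2 * t) = T at *
  generalize x ^ (2 * i) = I at *
  generalize hD : 1 - I * x ^ 2 = D at *
  field_simp
  rw [← hD]
  ring

theorem wellPoised_top {x : F} (hx : ∀ k, x ^ (k + 1) ≠ 1) (hx0 : x ≠ 0) (m : ℕ) :
    (1 - x ^ (4 * m + 1)) * beta x m * wellPoised x (x ^ (2 * m)) m * x ^ m =
      (1 - x ^ (2 * m + 1)) * evenProd x (x ^ (2 * m + 1) + (x ^ (2 * m + 1))⁻¹) m := by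
  have e1 : evenProd x (x ^ (2 * m + 1) + (x ^ (2 * m + 1))⁻¹) m =
      (∏ i ∈ Finset.range m, (1 - x ^ (2 * (i + 1)) * x ^ (2 * m + 1))) *
        ∏ i ∈ Finset.range m, (1 - x ^ (2 * i + 2) / x ^ (2 * m + 1)) := by
    rw [← Finset.prod_mul_distrib]
    exact Finset.prod_congr rfl fun i _ => pairFactor_add_inv hx0 _ _
  have e2 : wellPoised x (x ^ (2 * m)) m =
      (∏ i ∈ Finset.range m, (1 - x ^ (2 * i) / x ^ (2 * m))) *
        ∏ i ∈ Finset.range m, (1 - x ^ (2 * i) * x ^ (2 * m + 1)) := by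
    rw [← Finset.prod_mul_distrib]
    exact Finset.prod_congr rfl fun i _ => by ring
  -- The product of m + 1 factors is split off at its last and at its first factor; comparing the
  -- two yields 1 - x^(4m+1) against 1 - x^(2m+1).
  have e3 := Finset.prod_range_succ (fun i => 1 - x ^ (2 * i) * x ^ (2 * m + 1)) m
  rw [Finset.prod_range_succ'] at e3
  have e4 := prod_reflected_eq hx hx0 m
  have e5 : x ^ (2 * m) * x ^ (2 * m + 1) = x ^ (4 * m + 1) := by ring
  rw [e5, mul_zero, pow_zero, one_mul] at e3
  rw [e1, e2]
  linear_combination (1 - x ^ (4 * m + 1)) *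
    (∏ i ∈ Finset.range m, (1 - x ^ (2 * i) * x ^ (2 * m + 1))) * e4 -
    (∏ i ∈ Finset.range m, (1 - x ^ (2 * i + 2) / x ^ (2 * m + 1))) * e3

/-- A terminating very-well-poised summation. -/
theorem sum_wellPoised {x : F} (hx : ∀ k, x ^ (k + 1) ≠ 1) (hx0 : x ≠ 0) (m t : ℕ) :
    ∀ j, j + t = m → ∑ k ∈ Finset.range (m + 1), (1 - x ^ (4 * k + 1)) *
      (pairRatio x (x ^ (2 * m + 1) + (x ^ (2 * m + 1))⁻¹) k * beta x k ^ 2 *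
        wellPoised x (x ^ (2 * k)) j) =
      (1 - x ^ (2 * m + 1)) / x ^ m *
        (oddProd x (x ^ (2 * m + 1) + (x ^ (2 * m + 1))⁻¹) j * beta x j) := by
  set w := x ^ (2 * m + 1) + (x ^ (2 * m + 1))⁻¹ with hwdef
  have hw := pairFactor_root_even_ne_zero hx hx0 m
  rw [← hwdef] at hw
  induction t with
  | zero =>
    intro j hj
    obtain rfl : j = m := by omega
    -- Descending induction on j starts at j = m, where every term with k < m vanishes.
    rw [Finset.sum_eq_single_of_mem j (Finset.self_mem_range_succ j)]
    · have h1 : evenProd x w j ≠ 0 := evenProd_ne_zero fun i _ => hw i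
      have h2 : x ^ j ≠ 0 := pow_ne_zero _ hx0
      have h3 := wellPoised_top hx hx0 j
      rw [← hwdef] at h3
      rw [pairRatio_eq_div]
      field_simp
      linear_combination oddProd x w j * beta x j * h3
    · intro k hk hkj
      rw [wellPoised_eq_zero hx0 (by have := Finset.mem_range.mp hk; omega)]
      simp
  | succ t ih =>
    intro j hj
    have h1 := ih (j + 1) (by omega)
    have h2 := sum_wellPoised_step (w := w) hx hx0 j (m + 1) fun i _ => hw i
    -- This is where the special w enters: the last denominator cancels and the numerator factor of
    -- index 2m + 1 is zero, which removes the boundary term.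
    have h3 : pairRatio x w (m + 1) * pairFactor x w (2 * (m + 1)) = 0 := by
      rw [show pairRatio x w (m + 1) = pairRatio x w m *
        (pairFactor x w (2 * m + 1) / pairFactor x w (2 * m + 2)) from
        Finset.prod_range_succ _ _, hwdef, pairFactor_root_zero hx0]
      simp
    have h4 : x ^ (2 * j) * x ^ 2 / (1 - x ^ (2 * j + 2)) * (pairRatio x w (m + 1) *
        beta x (m + 1) ^ 2 * wellPoised x (x ^ (2 * (m + 1))) j) *
          pairFactor x w (2 * (m + 1)) * (1 - x ^ (2 * (m + 1))) *
          (x ^ (2 * j) - x ^ (2 * (m + 1))) / x ^ (2 * (m + 1)) = 0 := by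
      rw [div_eq_zero_iff]
      left
      linear_combination (x ^ (2 * j) * x ^ 2 / (1 - x ^ (2 * j + 2)) *
        beta x (m + 1) ^ 2 * wellPoised x (x ^ (2 * (m + 1))) j * (1 - x ^ (2 * (m + 1))) *
          (x ^ (2 * j) - x ^ (2 * (m + 1)))) * h3
    rw [h4] at h2
    set r := pairFactor x w (2 * j + 1) * (1 - x ^ (2 * j + 1)) / (1 - x ^ (2 * j + 2)) with hr
    have hr0 : r ≠ 0 := by
      refine div_ne_zero (mul_ne_zero ?_ (one_sub_ne hx _)) (one_sub_ne hx _)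
      exact pairFactor_root_ne_zero hx hx0 (by omega) (by omega)
    apply mul_left_cancel₀ hr0
    have h5 : r * ∑ k ∈ Finset.range (m + 1), (1 - x ^ (4 * k + 1)) *
          (pairRatio x w k * beta x k ^ 2 * wellPoised x (x ^ (2 * k)) j) =
        ∑ k ∈ Finset.range (m + 1), (1 - x ^ (4 * k + 1)) *
          (pairRatio x w k * beta x k ^ 2 * wellPoised x (x ^ (2 * k)) (j + 1)) := by
      rw [← sub_eq_zero, Finset.mul_sum, ← Finset.sum_sub_distrib, ← h2]
      exact Finset.sum_congr rfl fun k _ => by ring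
    rw [h5, h1, hr, show oddProd x w (j + 1) = oddProd x w j * pairFactor x w (2 * j + 1) from
      Finset.prod_range_succ _ _, show beta x (j + 1) = beta x j *
        ((1 - x ^ (2 * j + 1)) / (1 - x ^ (2 * j + 2))) from Finset.prod_range_succ _ _]
    ring

/-- A terminating case of Watson's transformation. -/
theorem terminating_watson {x w : F} (hx : ∀ k, x ^ (k + 1) ≠ 1) (hx0 : x ≠ 0) (m : ℕ)
    (hw : ∀ i, pairFactor x w (2 * i + 2) ≠ 0) :
    ∑ k ∈ Finset.range (m + 1), (1 - x ^ (4 * k + 1)) * x ^ k * (beta x k ^ 2 *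
      pairRatio x (x ^ (2 * m + 1) + (x ^ (2 * m + 1))⁻¹) k * pairRatio x w k) =
      (1 - x ^ (2 * m + 1)) / x ^ m * ∑ j ∈ Finset.range (m + 1), x ^ (2 * j) *
        (beta x j ^ 2 * oddProd x (x ^ (2 * m + 1) + (x ^ (2 * m + 1))⁻¹) j / evenProd x w j) := by
  set w' := x ^ (2 * m + 1) + (x ^ (2 * m + 1))⁻¹ with hw'
  -- Expand x^k times the ratio with general w by `pow_mul_pairRatio`, exchange the sums, and
  -- evaluate the sum over k by `sum_wellPoised`.
  calc _ = ∑ k ∈ Finset.range (m + 1), ∑ j ∈ Finset.range (m + 1),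
        beta x j * x ^ (2 * j) / evenProd x w j * ((1 - x ^ (4 * k + 1)) *
          (pairRatio x w' k * beta x k ^ 2 * wellPoised x (x ^ (2 * k)) j)) := by
        refine Finset.sum_congr rfl fun k hk => ?_
        have h := pow_mul_pairRatio (w := w) hx hx0 (m + 1) k (Finset.mem_range.mp hk)
          fun i _ => hw i
        have e : (1 - x ^ (4 * k + 1)) * x ^ k * (beta x k ^ 2 * pairRatio x w' k *
            pairRatio x w k) = (1 - x ^ (4 * k + 1)) * (beta x k ^ 2 * pairRatio x w' k) *
              (x ^ k * pairRatio x w k) := by ring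
        rw [e, h, Finset.mul_sum]
        exact Finset.sum_congr rfl fun j _ => by ring
    _ = _ := by
        rw [Finset.sum_comm, Finset.mul_sum]
        refine Finset.sum_congr rfl fun j hj => ?_
        rw [← Finset.mul_sum, sum_wellPoised hx hx0 m (m - j) j
          (by have := Finset.mem_range.mp hj; omega)]
        ring

end TransformationFormula

/-! ### Values and orders of vanishing of rational functions -/

/-- The rational function `x` is defined at `ζ` and has the value `z` there. -/
def SpecTo (ζ : ℂ) (x : RatFunc ℚ) (z : ℂ) : Prop :=
  ∃ a b : ℚ[X], aeval ζ b ≠ 0 ∧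
    x = algebraMap ℚ[X] (RatFunc ℚ) a / algebraMap ℚ[X] (RatFunc ℚ) b ∧
    z = aeval ζ a / aeval ζ b

theorem algebraMap_ne_zero_of_aeval {ζ : ℂ} {b : ℚ[X]} (hb : aeval ζ b ≠ 0) :
    algebraMap ℚ[X] (RatFunc ℚ) b ≠ 0 :=
  RatFunc.algebraMap_ne_zero fun h => hb (by rw [h, map_zero])

namespace SpecTo

variable {ζ : ℂ} {x y : RatFunc ℚ} {z w : ℂ}

theorem of_polynomial (ζ : ℂ) (a : ℚ[X]) :
    SpecTo ζ (algebraMap ℚ[X] (RatFunc ℚ) a) (aeval ζ a) :=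
  ⟨a, 1, by simp, by simp, by simp⟩

theorem zero (ζ : ℂ) : SpecTo ζ 0 0 := by simpa using of_polynomial ζ 0

theorem one (ζ : ℂ) : SpecTo ζ 1 1 := by simpa using of_polynomial ζ 1

theorem q_self (ζ : ℂ) : SpecTo ζ q ζ := by
  simpa [q, RatFunc.algebraMap_X] using of_polynomial ζ X

theorem add (hx : SpecTo ζ x z) (hy : SpecTo ζ y w) : SpecTo ζ (x + y) (z + w) := by
  obtain ⟨a, b, hb, rfl, rfl⟩ := hx
  obtain ⟨c, d, hd, rfl, rfl⟩ := hy
  refine ⟨a * d + b * c, b * d, by simp [hb, hd], ?_, ?_⟩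
  · rw [div_add_div _ _ (algebraMap_ne_zero_of_aeval hb) (algebraMap_ne_zero_of_aeval hd)]
    simp
  · rw [div_add_div _ _ hb hd]; simp

theorem mul (hx : SpecTo ζ x z) (hy : SpecTo ζ y w) : SpecTo ζ (x * y) (z * w) := by
  obtain ⟨a, b, hb, rfl, rfl⟩ := hx
  obtain ⟨c, d, hd, rfl, rfl⟩ := hy
  exact ⟨a * c, b * d, by simp [hb, hd], by rw [div_mul_div_comm]; simp,
    by rw [div_mul_div_comm]; simp⟩

theorem neg (hx : SpecTo ζ x z) : SpecTo ζ (-x) (-z) := by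
  obtain ⟨a, b, hb, rfl, rfl⟩ := hx
  exact ⟨-a, b, hb, by simp [neg_div], by simp [neg_div]⟩

theorem sub (hx : SpecTo ζ x z) (hy : SpecTo ζ y w) : SpecTo ζ (x - y) (z - w) := by
  simpa only [sub_eq_add_neg] using hx.add hy.neg

theorem inv (hx : SpecTo ζ x z) (hz : z ≠ 0) : SpecTo ζ x⁻¹ z⁻¹ := by
  obtain ⟨a, b, hb, rfl, rfl⟩ := hx
  exact ⟨b, a, (div_ne_zero_iff.mp hz).1, by simp, by simp⟩

theorem div (hx : SpecTo ζ x z) (hy : SpecTo ζ y w) (hw : w ≠ 0) :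
    SpecTo ζ (x / y) (z / w) := by
  simpa only [div_eq_mul_inv] using hx.mul (hy.inv hw)

theorem pow (hx : SpecTo ζ x z) (k : ℕ) : SpecTo ζ (x ^ k) (z ^ k) := by
  induction k with
  | zero => simpa using one ζ
  | succ k ih => simpa only [pow_succ] using ih.mul hx

theorem sum {ι : Type*} (s : Finset ι) {f : ι → RatFunc ℚ} {g : ι → ℂ}
    (h : ∀ i ∈ s, SpecTo ζ (f i) (g i)) : SpecTo ζ (∑ i ∈ s, f i) (∑ i ∈ s, g i) := by
  classical
  induction s using Finset.induction_on with
  | empty => simpa using zero ζ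
  | insert i s hi ih =>
    rw [Finset.sum_insert hi, Finset.sum_insert hi]
    exact (h i (Finset.mem_insert_self i s)).add
      (ih fun j hj => h j (Finset.mem_insert_of_mem hj))

theorem prod {ι : Type*} (s : Finset ι) {f : ι → RatFunc ℚ} {g : ι → ℂ}
    (h : ∀ i ∈ s, SpecTo ζ (f i) (g i)) : SpecTo ζ (∏ i ∈ s, f i) (∏ i ∈ s, g i) := by
  classical
  induction s using Finset.induction_on with
  | empty => simpa using one ζ
  | insert i s hi ih =>
    rw [Finset.prod_insert hi, Finset.prod_insert hi]
    exact (h i (Finset.mem_insert_self i s)).mul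
      (ih fun j hj => h j (Finset.mem_insert_of_mem hj))

theorem two (ζ : ℂ) : SpecTo ζ 2 2 := by
  simpa only [one_add_one_eq_two] using (one ζ).add (one ζ)

theorem one_sub_q_pow (ζ : ℂ) (k : ℕ) : SpecTo ζ (1 - q ^ k) (1 - ζ ^ k) :=
  (one ζ).sub ((q_self ζ).pow k)

end SpecTo

/-- The rational function `x` is `P ^ e` times a rational function defined at `ζ`. -/
def OrdGE (P : ℚ[X]) (ζ : ℂ) (e : ℕ) (x : RatFunc ℚ) : Prop :=
  ∃ y z, SpecTo ζ y z ∧ x = algebraMap ℚ[X] (RatFunc ℚ) P ^ e * y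

theorem SpecTo.ordGE_zero {P : ℚ[X]} {ζ : ℂ} {x : RatFunc ℚ} {z : ℂ} (h : SpecTo ζ x z) :
    OrdGE P ζ 0 x := ⟨x, z, h, by simp⟩

theorem SpecTo.ordGE_one {P : ℚ[X]} {ζ : ℂ} {x : RatFunc ℚ}
    (hP : ∀ a : ℚ[X], aeval ζ a = 0 → P ∣ a) (h : SpecTo ζ x 0) : OrdGE P ζ 1 x := by
  obtain ⟨a, b, hb, rfl, hz⟩ := h
  have ha : aeval ζ a = 0 := ((div_eq_zero_iff.mp hz.symm).resolve_right hb)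
  obtain ⟨c, rfl⟩ := hP a ha
  exact ⟨_, _, ⟨c, b, hb, rfl, rfl⟩, by simp [mul_div_assoc]⟩

namespace OrdGE

variable {P : ℚ[X]} {ζ : ℂ} {e f : ℕ} {x y : RatFunc ℚ}

theorem zero (P : ℚ[X]) (ζ : ℂ) (e : ℕ) : OrdGE P ζ e 0 := ⟨0, 0, SpecTo.zero ζ, by simp⟩

theorem add (hx : OrdGE P ζ e x) (hy : OrdGE P ζ e y) : OrdGE P ζ e (x + y) := by
  obtain ⟨u, a, hu, rfl⟩ := hx
  obtain ⟨v, b, hv, rfl⟩ := hy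
  exact ⟨u + v, _, hu.add hv, by ring⟩

theorem neg (hx : OrdGE P ζ e x) : OrdGE P ζ e (-x) := by
  obtain ⟨u, a, hu, rfl⟩ := hx
  exact ⟨-u, _, hu.neg, by ring⟩

theorem sub (hx : OrdGE P ζ e x) (hy : OrdGE P ζ e y) : OrdGE P ζ e (x - y) := by
  simpa only [sub_eq_add_neg] using hx.add hy.neg

theorem mul (hx : OrdGE P ζ e x) (hy : OrdGE P ζ f y) : OrdGE P ζ (e + f) (x * y) := by
  obtain ⟨u, a, hu, rfl⟩ := hx
  obtain ⟨v, b, hv, rfl⟩ := hy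
  exact ⟨u * v, _, hu.mul hv, by ring⟩

theorem pow (hx : OrdGE P ζ e x) (k : ℕ) : OrdGE P ζ (k * e) (x ^ k) := by
  obtain ⟨u, a, hu, rfl⟩ := hx
  exact ⟨u ^ k, _, hu.pow k, by rw [mul_pow, ← pow_mul, mul_comm k]⟩

theorem mul_spec {z : ℂ} (hx : OrdGE P ζ e x) (hy : SpecTo ζ y z) : OrdGE P ζ e (x * y) :=
  hx.mul hy.ordGE_zero

theorem mono (hx : OrdGE P ζ e x) (h : f ≤ e) : OrdGE P ζ f x := by
  obtain ⟨u, a, hu, rfl⟩ := hx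
  obtain ⟨g, rfl⟩ := Nat.exists_eq_add_of_le h
  exact ⟨_, _, ((SpecTo.of_polynomial ζ P).pow g).mul hu, by ring⟩

theorem sum {ι : Type*} (s : Finset ι) {f : ι → RatFunc ℚ}
    (h : ∀ i ∈ s, OrdGE P ζ e (f i)) : OrdGE P ζ e (∑ i ∈ s, f i) := by
  classical
  induction s using Finset.induction_on with
  | empty => simpa using zero P ζ e
  | insert i s hi ih =>
    rw [Finset.sum_insert hi]
    exact (h i (Finset.mem_insert_self i s)).add
      (ih fun j hj => h j (Finset.mem_insert_of_mem hj))

theorem exists_spec (hx : OrdGE P ζ e x) : ∃ z, SpecTo ζ x z := by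
  obtain ⟨u, a, hu, rfl⟩ := hx
  exact ⟨_, ((SpecTo.of_polynomial ζ P).pow e).mul hu⟩

/-- The denominator b is nonzero at ζ while P vanishes there, so P does not divide b and the whole
power passes to the numerator. -/
theorem pow_dvd_num (hP : Prime P) (hζ : aeval ζ P = 0) (hx : OrdGE P ζ e x) :
    P ^ e ∣ x.num := by
  obtain ⟨u, z, ⟨a, b, hb, rfl, -⟩, hx⟩ := hx
  have hPb : ¬ P ∣ b := by
    rintro ⟨c, rfl⟩
    exact hb (by simp [hζ])
  refine hP.pow_dvd_of_dvd_mul_right e hPb ⟨a * x.denom, ?_⟩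
  apply RatFunc.algebraMap_injective ℚ
  have h1 : algebraMap ℚ[X] (RatFunc ℚ) b ≠ 0 := algebraMap_ne_zero_of_aeval hb
  have h2 : algebraMap ℚ[X] (RatFunc ℚ) x.denom ≠ 0 :=
    RatFunc.algebraMap_ne_zero x.denom_ne_zero
  rw [← RatFunc.num_div_denom x, ← mul_div_assoc, div_eq_div_iff h2 h1] at hx
  simp only [map_mul, map_pow]
  rw [hx]; ring

end OrdGE

theorem q_ne_zero : q ≠ 0 := RatFunc.X_ne_zero

theorem q_pow_ne_one (k : ℕ) : q ^ (k + 1) ≠ 1 := by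
  intro h
  have h1 : algebraMap ℚ[X] (RatFunc ℚ) (X ^ (k + 1)) = algebraMap ℚ[X] (RatFunc ℚ) 1 := by
    simpa [q, RatFunc.algebraMap_X] using h
  have h2 := congrArg (Polynomial.eval 0) (RatFunc.algebraMap_injective ℚ h1)
  simp at h2

theorem beta_q_eq (k : ℕ) : beta q k = qPoch q (q ^ 2) k / qPoch (q ^ 2) (q ^ 2) k := by
  rw [beta, qPoch, qPoch, ← Finset.prod_div_distrib]
  exact Finset.prod_congr rfl fun i _ => by ring

theorem theta_eq (k : ℕ) : theta k = qInt (4 * k + 1) * beta q k ^ 6 * q ^ k := by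
  rw [theta, beta_q_eq, div_pow]

theorem term_eq (k : ℕ) : term k = beta q k ^ 4 * q ^ (2 * k) := by
  rw [term, beta_q_eq, div_pow]

/-! ### Values at roots of unity and the reflection symmetry -/

section RootOfUnity

variable {ζ : ℂ} {d : ℕ}

theorem one_sub_pow_ne_zero (hζ : IsPrimitiveRoot ζ d) {k : ℕ} (hk : ¬ d ∣ k) :
    1 - ζ ^ k ≠ 0 := fun h =>
  hk ((hζ.pow_eq_one_iff_dvd k).mp (sub_eq_zero.mp h).symm)

theorem SpecTo.qInt (hζ : IsPrimitiveRoot ζ d) (hd : 1 < d) (r : ℕ) :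
    SpecTo ζ (QSuper.qInt r) ((1 - ζ ^ r) / (1 - ζ)) := by
  have h := one_sub_pow_ne_zero hζ (k := 1) (by rw [Nat.dvd_one]; omega)
  rw [pow_one] at h
  exact (SpecTo.one_sub_q_pow ζ r).div (by simpa using SpecTo.one_sub_q_pow ζ 1) h

/-- Cancelling 1 - q^d leaves geometric sums in q^d, with values u and v at ζ. -/
theorem SpecTo.one_sub_div_one_sub (hζ : IsPrimitiveRoot ζ d) (hd : 0 < d) (u : ℕ) {v : ℕ}
    (hv : 0 < v) : SpecTo ζ ((1 - q ^ (d * u)) / (1 - q ^ (d * v))) (u / v) := by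
  have h1 (t : ℕ) : (1 - q ^ d) * (∑ i ∈ Finset.range t, (q ^ d) ^ i) = 1 - q ^ (d * t) := by
    rw [mul_neg_geom_sum, pow_mul]
  have h2 (t : ℕ) : SpecTo ζ (∑ i ∈ Finset.range t, (q ^ d) ^ i) t := by
    have := SpecTo.sum (Finset.range t) fun i _ => ((SpecTo.q_self ζ).pow d).pow i
    simpa [hζ.pow_eq_one] using this
  have h3 : 1 - q ^ d ≠ 0 := by
    obtain ⟨e, rfl⟩ := Nat.exists_eq_succ_of_ne_zero hd.ne'
    exact one_sub_ne q_pow_ne_one e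
  rw [← h1, ← h1, mul_div_mul_left _ _ h3]
  exact (h2 u).div (h2 v) (by exact_mod_cast hv.ne')

theorem exists_spec_one_sub_div (hζ : IsPrimitiveRoot ζ d) (hd : 0 < d) {u v : ℕ} (hu : d ∣ u)
    (hv : 0 < v) : ∃ z, SpecTo ζ ((1 - q ^ u) / (1 - q ^ v)) z := by
  by_cases h : d ∣ v
  · obtain ⟨a, rfl⟩ := hu
    obtain ⟨b, rfl⟩ := h
    exact ⟨_, SpecTo.one_sub_div_one_sub hζ hd a (Nat.pos_of_mul_pos_left hv)⟩
  · exact ⟨_, (SpecTo.one_sub_q_pow ζ u).div (SpecTo.one_sub_q_pow ζ v)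
      (one_sub_pow_ne_zero hζ h)⟩

variable {e : ℕ}

theorem not_dvd_even {i : ℕ} (hi : i + 1 < 2 * e + 1) : ¬ (2 * e + 1) ∣ 2 * i + 2 := by
  intro h
  have h1 : (2 * e + 1) ∣ 2 * (i + 1) := by rwa [mul_add]
  have h2 : Nat.Coprime (2 * e + 1) 2 := by simp
  exact absurd (Nat.le_of_dvd (by omega) (h2.dvd_of_dvd_mul_left h1)) (by omega)

theorem not_dvd_odd {i : ℕ} (hi : i < 2 * e + 1) (hie : i ≠ e) :
    ¬ (2 * e + 1) ∣ 2 * i + 1 := by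
  rintro ⟨c, hc⟩
  have h1 : c < 2 := by nlinarith
  interval_cases c <;> omega

/-- Each block of 2e + 1 factors has one vanishing numerator (i = e) and one vanishing denominator
(i = 2e). Their quotient is regular at ζ, so these two zeros are paired off. -/
theorem exists_spec_beta_block (hζ : IsPrimitiveRoot ζ (2 * e + 1)) (a : ℕ) :
    ∃ z, SpecTo ζ (beta q ((2 * e + 1) * a)) z := by
  induction a with
  | zero => exact ⟨1, by simpa [beta] using SpecTo.one ζ⟩
  | succ a ih =>
    obtain ⟨z, hz⟩ := ih
    have hpow (k : ℕ) : ζ ^ (2 * ((2 * e + 1) * a) + k) = ζ ^ k := by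
      rw [pow_add, mul_left_comm, pow_mul, hζ.pow_eq_one, one_pow, one_mul]
    have h1 : beta q ((2 * e + 1) * (a + 1)) = beta q ((2 * e + 1) * a) *
        ∏ i ∈ Finset.range (2 * e + 1), (1 - q ^ (2 * ((2 * e + 1) * a + i) + 1)) /
          (1 - q ^ (2 * ((2 * e + 1) * a + i) + 2)) := by
      rw [mul_add, mul_one]; exact Finset.prod_range_add _ _ _
    have h2 : ∏ i ∈ Finset.range (2 * e + 1), (1 - q ^ (2 * ((2 * e + 1) * a + i) + 1)) /
          (1 - q ^ (2 * ((2 * e + 1) * a + i) + 2)) =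
        (1 - q ^ ((2 * e + 1) * (2 * a + 1))) / (1 - q ^ ((2 * e + 1) * (2 * a + 2))) *
        ((∏ i ∈ (Finset.range (2 * e + 1)).erase e,
          (1 - q ^ (2 * ((2 * e + 1) * a) + (2 * i + 1)))) /
        ∏ i ∈ Finset.range (2 * e), (1 - q ^ (2 * ((2 * e + 1) * a) + (2 * i + 2)))) := by
      rw [Finset.prod_div_distrib, ← Finset.mul_prod_erase _ _
        (Finset.mem_range.mpr (by omega : e < 2 * e + 1)),
        Finset.prod_range_succ (fun i => 1 - q ^ (2 * ((2 * e + 1) * a + i) + 2)),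
        mul_comm (∏ i ∈ Finset.range (2 * e), _), ← div_mul_div_comm]
      congr 1
      · congr 3 <;> ring
      · congr 1
        · exact Finset.prod_congr rfl fun i _ => by congr 2; ring
        · exact Finset.prod_congr rfl fun i _ => by congr 2; ring
    rw [h1, h2]
    refine ⟨_, hz.mul ((SpecTo.one_sub_div_one_sub hζ (by omega) _ (by omega)).mul
      ((SpecTo.prod _ fun i _ => SpecTo.one_sub_q_pow ζ _).div
        (SpecTo.prod _ fun i _ => SpecTo.one_sub_q_pow ζ _) ?_))⟩
    refine Finset.prod_ne_zero_iff.mpr fun i hi => ?_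
    rw [hpow]
    exact one_sub_pow_ne_zero hζ (not_dvd_even (by have := Finset.mem_range.mp hi; omega))

/-- A `q`-Lucas theorem for `(q;q²)_k / (q²;q²)_k`. -/
theorem exists_spec_beta (hζ : IsPrimitiveRoot ζ (2 * e + 1)) (a : ℕ) :
    ∃ c, ∀ b < 2 * e + 1, SpecTo ζ (beta q ((2 * e + 1) * a + b)) (c * beta ζ b) := by
  obtain ⟨c, hc⟩ := exists_spec_beta_block hζ a
  refine ⟨c, fun b hb => ?_⟩
  have hpow (k : ℕ) : ζ ^ (2 * ((2 * e + 1) * a) + k) = ζ ^ k := by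
    rw [pow_add, mul_left_comm, pow_mul, hζ.pow_eq_one, one_pow, one_mul]
  have h1 : beta q ((2 * e + 1) * a + b) = beta q ((2 * e + 1) * a) *
      ∏ i ∈ Finset.range b, (1 - q ^ (2 * ((2 * e + 1) * a + i) + 1)) /
        (1 - q ^ (2 * ((2 * e + 1) * a + i) + 2)) := Finset.prod_range_add _ _ _
  rw [h1]
  refine hc.mul (SpecTo.prod _ fun i hi => ?_)
  have h2 := (SpecTo.one_sub_q_pow ζ (2 * ((2 * e + 1) * a + i) + 1)).div
    (SpecTo.one_sub_q_pow ζ (2 * ((2 * e + 1) * a + i) + 2))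
  rw [mul_add, add_assoc, add_assoc, hpow, hpow] at h2
  rw [mul_add, add_assoc, add_assoc]
  exact h2 (one_sub_pow_ne_zero hζ (not_dvd_even (by have := Finset.mem_range.mp hi; omega)))

theorem spec_beta (hζ : IsPrimitiveRoot ζ (2 * e + 1)) {b : ℕ} (hb : b < 2 * e + 1) :
    SpecTo ζ (beta q b) (beta ζ b) := by
  refine SpecTo.prod _ fun i hi => (SpecTo.one_sub_q_pow ζ _).div (SpecTo.one_sub_q_pow ζ _) ?_
  exact one_sub_pow_ne_zero hζ (not_dvd_even (by have := Finset.mem_range.mp hi; omega))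

theorem exists_spec_beta' (hζ : IsPrimitiveRoot ζ (2 * e + 1)) (k : ℕ) :
    ∃ z, SpecTo ζ (beta q k) z := by
  obtain ⟨c, hc⟩ := exists_spec_beta hζ (k / (2 * e + 1))
  have := hc (k % (2 * e + 1)) (Nat.mod_lt _ (by omega))
  rw [Nat.div_add_mod] at this
  exact ⟨_, this⟩

theorem beta_eq_zero (hζ : IsPrimitiveRoot ζ (2 * e + 1)) {b : ℕ} (hb : e < b) :
    beta ζ b = 0 := by
  refine Finset.prod_eq_zero (Finset.mem_range.mpr hb) ?_
  rw [hζ.pow_eq_one]; simp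

/-- Odd exponents s correspond to even exponents 2e + 1 - s, and 1 - ζ^(-s) = -ζ^(-s)(1 - ζ^s) turns
the factors removed at the top into those added at the bottom. -/
theorem beta_reflect (hζ : IsPrimitiveRoot ζ (2 * e + 1)) {k : ℕ} :
    k ≤ e → beta ζ (e - k) = beta ζ e * ζ ^ k * beta ζ k := by
  have hζ0 : ζ ≠ 0 := hζ.ne_zero (by omega)
  induction k with
  | zero => simp [beta]
  | succ k ih =>
    intro hk
    have ih := ih (by omega)
    obtain ⟨t, rfl⟩ := Nat.exists_eq_add_of_le hk
    have e1 : k + 1 + t - k = t + 1 := by omega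
    have e2 : k + 1 + t - (k + 1) = t := by omega
    rw [e1] at ih
    rw [e2]
    have h1 : beta ζ (t + 1) = beta ζ t * ((1 - ζ ^ (2 * t + 1)) / (1 - ζ ^ (2 * t + 2))) :=
      Finset.prod_range_succ _ _
    have h2 : beta ζ (k + 1) = beta ζ k * ((1 - ζ ^ (2 * k + 1)) / (1 - ζ ^ (2 * k + 2))) :=
      Finset.prod_range_succ _ _
    have h3 : 1 - ζ ^ (2 * t + 1) ≠ 0 :=
      one_sub_pow_ne_zero hζ (not_dvd_odd (by omega) (by omega))
    have h4 : 1 - ζ ^ (2 * t + 2) ≠ 0 := one_sub_pow_ne_zero hζ (not_dvd_even (by omega))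
    have h5 : 1 - ζ ^ (2 * k + 2) ≠ 0 := one_sub_pow_ne_zero hζ (not_dvd_even (by omega))
    have h6 : ζ ^ (2 * t + 1) * ζ ^ (2 * k + 2) = 1 := by
      rw [← hζ.pow_eq_one]; ring
    have h7 : ζ ^ (2 * t + 2) * ζ ^ (2 * k + 1) = 1 := by
      rw [← hζ.pow_eq_one]; ring
    have h8 : ζ ^ (2 * k + 2) = ζ * ζ ^ (2 * k + 1) := by ring
    rw [h1] at ih
    rw [h2]
    have h9 : (1 - ζ ^ (2 * k + 1)) * (1 - ζ ^ (2 * t + 1)) * ζ =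
        (1 - ζ ^ (2 * k + 2)) * (1 - ζ ^ (2 * t + 2)) := by
      have h10 : ζ ^ (2 * t + 2) = ζ * ζ ^ (2 * t + 1) := by ring
      rw [h8] at h6 ⊢
      rw [h10] at h7 ⊢
      linear_combination (1 - ζ) * h6
    generalize ζ ^ (2 * t + 1) = T at *
    generalize ζ ^ (2 * t + 2) = T' at *
    generalize ζ ^ (2 * k + 1) = K at *
    generalize ζ ^ (2 * k + 2) = K' at *
    rw [pow_succ]
    field_simp at ih ⊢
    apply mul_left_cancel₀ h3
    linear_combination (1 - K') * ih - beta ζ (k + 1 + t) * ζ ^ k * beta ζ k * h9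

theorem sq_beta_mul_pow (hζ : IsPrimitiveRoot ζ (2 * e + 1)) : beta ζ e ^ 2 * ζ ^ e = 1 := by
  have h := beta_reflect hζ le_rfl
  rw [Nat.sub_self] at h
  have h0 : beta ζ 0 = 1 := by simp [beta]
  rw [h0] at h
  rw [h]; ring

/-- The sum of `x ^ j / (1 - x ^ j) ^ 2` over `1 ≤ j ≤ 2k`, with alternating signs. -/
def altSum {F : Type*} [Field F] (x : F) (k : ℕ) : F := ∑ i ∈ Finset.range k,
  (x ^ (2 * i + 2) / (1 - x ^ (2 * i + 2)) ^ 2 - x ^ (2 * i + 1) / (1 - x ^ (2 * i + 1)) ^ 2)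

/-- The term ζ^s/(1 - ζ^s)² is even in s mod 2e + 1, and s ↦ 2e + 1 - s swaps parities. This gives
the symmetry up to the constant `altSum ζ e`; taking j = e in `key` shows that the constant is zero.
-/
theorem altSum_reflect (hζ : IsPrimitiveRoot ζ (2 * e + 1)) {k : ℕ} (hk : k ≤ e) :
    altSum ζ (e - k) = altSum ζ k := by
  have hu {s t : ℕ} (h : s + t = 2 * e + 1) :
      ζ ^ s / (1 - ζ ^ s) ^ 2 = ζ ^ t / (1 - ζ ^ t) ^ 2 := by
    have h1 : ζ ^ s * ζ ^ t = 1 := by rw [← pow_add, h, hζ.pow_eq_one]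
    by_cases h2 : 1 - ζ ^ s = 0
    · have h3 : ζ ^ s = 1 := (sub_eq_zero.mp h2).symm
      rw [h3, one_mul] at h1
      rw [h3, h1]
    · have h3 : 1 - ζ ^ t ≠ 0 := by
        intro h3
        rw [← sub_eq_zero.mp h3, mul_one] at h1
        exact h2 (by rw [h1, sub_self])
      rw [div_eq_div_iff (pow_ne_zero _ h2) (pow_ne_zero _ h3)]
      linear_combination (ζ ^ t - ζ ^ s) * h1
  have key (j : ℕ) (hj : j ≤ e) : altSum ζ (e - j) = altSum ζ e + altSum ζ j := by
    induction j with
    | zero => simp [altSum]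
    | succ j ih =>
      have ih := ih (by omega)
      obtain ⟨t, ht⟩ := Nat.exists_eq_add_of_le hj
      have e1 : e - j = t + 1 := by omega
      have e2 : e - (j + 1) = t := by omega
      rw [e1, altSum, Finset.sum_range_succ, ← altSum] at ih
      rw [e2]
      have h1 := hu (s := 2 * t + 2) (t := 2 * j + 1) (by omega)
      have h2 := hu (s := 2 * t + 1) (t := 2 * j + 2) (by omega)
      rw [h1, h2] at ih
      have h3 : altSum ζ (j + 1) = altSum ζ j + (ζ ^ (2 * j + 2) / (1 - ζ ^ (2 * j + 2)) ^ 2 -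
        ζ ^ (2 * j + 1) / (1 - ζ ^ (2 * j + 1)) ^ 2) := Finset.sum_range_succ _ _
      rw [h3]
      linear_combination ih
  have h1 := key e le_rfl
  have h0 : altSum ζ 0 = 0 := by simp [altSum]
  rw [Nat.sub_self, h0] at h1
  rw [key k hk]
  linear_combination -h1 / 2

/-- The weight in front of h changes sign under k ↦ e - k, so the sum equals its negative. It is
used with h constant and with h the square of `altSum`. -/
theorem sum_eq_zero_of_reflect (hζ : IsPrimitiveRoot ζ (2 * e + 1)) (h : ℕ → ℂ)
    (hh : ∀ k ≤ e, h (e - k) = h k) :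
    ∑ k ∈ Finset.range (e + 1), (1 - ζ ^ (4 * k + 1)) * beta ζ k ^ 6 * ζ ^ k * h k = 0 := by
  have h1 : ∑ k ∈ Finset.range (e + 1), (1 - ζ ^ (4 * k + 1)) * beta ζ k ^ 6 * ζ ^ k * h k =
      -∑ k ∈ Finset.range (e + 1), (1 - ζ ^ (4 * k + 1)) * beta ζ k ^ 6 * ζ ^ k * h k := by
    rw [← Finset.sum_neg_distrib]
    conv_lhs => rw [← Finset.sum_range_reflect]
    refine Finset.sum_congr rfl fun k hk => ?_
    have hk := Nat.le_of_lt_succ (Finset.mem_range.mp hk)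
    have e1 : e + 1 - 1 - k = e - k := by omega
    rw [e1, hh k hk, beta_reflect hζ hk]
    have h2 := sq_beta_mul_pow hζ
    obtain ⟨t, rfl⟩ := Nat.exists_eq_add_of_le hk
    have e2 : k + t - k = t := by omega
    have hζn := hζ.pow_eq_one
    rw [e2]
    have h3 : beta ζ (k + t) ^ 6 * ζ ^ (3 * k + 3 * t) = 1 := by
      have : beta ζ (k + t) ^ 6 * ζ ^ (3 * k + 3 * t) = (beta ζ (k + t) ^ 2 * ζ ^ (k + t)) ^ 3 := by
        ring
      rw [this, h2, one_pow]
    have h4 : ζ ^ (2 * k + 2 * t + 1) = 1 := by rw [← hζn]; ring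
    have hζ0 : ζ ≠ 0 := hζ.ne_zero (by omega)
    -- The extra power completes exponents to multiples of the order 2(k + t) + 1 and avoids
    -- negative powers.
    apply mul_left_cancel₀ (pow_ne_zero (2 * t + 1) hζ0)
    have h5 : ζ ^ (2 * t + 1) * (1 - ζ ^ (4 * t + 1)) * ζ ^ (3 * k) * ζ ^ (3 * k) * ζ ^ t =
        -(ζ ^ (2 * t + 1) * (1 - ζ ^ (4 * k + 1)) * ζ ^ k * ζ ^ (3 * k + 3 * t)) := by
      have a1 : ζ ^ (2 * t + 1) * (1 - ζ ^ (4 * t + 1)) * ζ ^ (3 * k) * ζ ^ (3 * k) * ζ ^ t =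
        ζ ^ (2 * k + 2 * t + 1) * ζ ^ (4 * k + t) -
          (ζ ^ (2 * k + 2 * t + 1)) ^ 2 * ζ ^ (2 * k + 3 * t) := by ring
      have a2 : ζ ^ (2 * t + 1) * (1 - ζ ^ (4 * k + 1)) * ζ ^ k * ζ ^ (3 * k + 3 * t) =
          ζ ^ (2 * k + 2 * t + 1) * ζ ^ (2 * k + 3 * t) -
          (ζ ^ (2 * k + 2 * t + 1)) ^ 2 * ζ ^ (4 * k + t) := by ring
      rw [a1, a2, h4]; ring
    linear_combination beta ζ (k + t) ^ 6 * beta ζ k ^ 6 * h k * h5 -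
      ζ ^ (2 * t + 1) * (1 - ζ ^ (4 * k + 1)) * beta ζ k ^ 6 * ζ ^ k * h k * h3
  exact self_eq_neg.mp h1

end RootOfUnity

/-! ### The two sides and their vanishing modulo Φ_d for d ≠ 1 -/

/-- The left-hand side of the congruence. -/
noncomputable def doubleSum (n : ℕ) : RatFunc ℚ :=
  ∑ p ∈ (Finset.range n ×ˢ Finset.range n).filter (fun p => p.1 + p.2 ≤ n - 1),
    theta p.1 * theta p.2

/-- The right-hand side of the congruence. -/
noncomputable def productSide (n : ℕ) : RatFunc ℚ :=
  qInt n ^ 2 * q ^ (1 - (n : ℤ)) * (∑ k ∈ Finset.range ((n - 1) / 2 + 1), term k) *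
    ∑ k ∈ Finset.range ((n - 1) / 2 + 1), term k *
      (1 - 2 * (2 - q ^ n) * qInt n ^ 2 * ∑ t ∈ Finset.Icc 1 (2 * k), q ^ t / qInt t ^ 2)

theorem sum_triangle {R : Type*} [CommRing R] (f : ℕ → R) (n : ℕ) :
    ∑ p ∈ (Finset.range n ×ˢ Finset.range n).filter (fun p => p.1 + p.2 ≤ n - 1),
      f p.1 * f p.2 = ∑ i ∈ Finset.range n, f i * ∑ j ∈ Finset.range (n - i), f j := by
  rw [Finset.sum_filter, Finset.sum_product]
  refine Finset.sum_congr rfl fun i hi => ?_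
  have hi := Finset.mem_range.mp hi
  rw [← Finset.sum_filter, Finset.mul_sum]
  refine Finset.sum_congr ?_ fun _ _ => rfl
  ext j
  simp only [Finset.mem_filter, Finset.mem_range]
  omega

theorem doubleSum_eq (n : ℕ) :
    doubleSum n = ∑ i ∈ Finset.range n, theta i * ∑ j ∈ Finset.range (n - i), theta j :=
  sum_triangle theta n

/-- Makes [n]² q^(1-n) visibly the square of the prefactor [n] q^(-m) coming from Watson's
transformation. -/
theorem zpow_one_sub (m : ℕ) : q ^ (1 - ((2 * m + 1 : ℕ) : ℤ)) = (q ^ m)⁻¹ ^ 2 := by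
  rw [show (1 - ((2 * m + 1 : ℕ) : ℤ)) = -((2 * m : ℕ) : ℤ) by push_cast; ring, zpow_neg,
    zpow_natCast, inv_pow, ← pow_mul, mul_comm 2]

/-- The right-hand side of the congruence, with all denominators collected. -/
theorem productSide_eq (m : ℕ) : productSide (2 * m + 1) =
    qInt (2 * m + 1) ^ 2 * (q ^ m)⁻¹ ^ 2 *
      (∑ k ∈ Finset.range (m + 1), beta q k ^ 4 * q ^ (2 * k)) *
      ∑ k ∈ Finset.range (m + 1), beta q k ^ 4 * q ^ (2 * k) * (1 - 2 * (2 - q ^ (2 * m + 1)) *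
        ∑ t ∈ Finset.Icc 1 (2 * k), q ^ t * ((1 - q ^ (2 * m + 1)) / (1 - q ^ t)) ^ 2) := by
  have e1 : (2 * m + 1 - 1) / 2 = m := by omega
  rw [productSide, e1, zpow_one_sub]
  simp only [term_eq]
  congr 1
  refine Finset.sum_congr rfl fun k _ => ?_
  rw [mul_assoc (2 * (2 - q ^ (2 * m + 1)))]
  congr 3
  rw [Finset.mul_sum]
  refine Finset.sum_congr rfl fun t ht => ?_
  obtain ⟨s, rfl⟩ := Nat.exists_eq_add_of_le (Finset.mem_Icc.mp ht).1
  have h1 := one_sub_ne q_pow_ne_one s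
  rw [add_comm] at h1
  have h2 := one_sub_q_ne_zero
  simp only [qInt]
  generalize 1 - q ^ (1 + s) = a at *
  generalize 1 - q = b at *
  field_simp

section RootOfUnity

variable {ζ : ℂ} {e : ℕ}

/-- The value of `theta b` at a root of unity. -/
noncomputable def thetaRoot (ζ : ℂ) (b : ℕ) : ℂ :=
  (1 - ζ ^ (4 * b + 1)) / (1 - ζ) * beta ζ b ^ 6 * ζ ^ b

theorem exists_spec_theta (hζ : IsPrimitiveRoot ζ (2 * e + 1)) (he : 0 < e) (a : ℕ) :
    ∃ c, ∀ b < 2 * e + 1, SpecTo ζ (theta ((2 * e + 1) * a + b)) (c * thetaRoot ζ b) := by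
  obtain ⟨c, hc⟩ := exists_spec_beta hζ a
  refine ⟨c ^ 6, fun b hb => ?_⟩
  have h := ((SpecTo.qInt hζ (by omega) (4 * ((2 * e + 1) * a + b) + 1)).mul
    ((hc b hb).pow 6)).mul ((SpecTo.q_self ζ).pow ((2 * e + 1) * a + b))
  rw [← theta_eq] at h
  have e1 : ζ ^ ((2 * e + 1) * a + b) = ζ ^ b := by
    rw [pow_add, pow_mul, hζ.pow_eq_one, one_pow, one_mul]
  have e2 : ζ ^ (4 * ((2 * e + 1) * a + b) + 1) = ζ ^ (4 * b + 1) := by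
    rw [show 4 * ((2 * e + 1) * a + b) + 1 = (2 * e + 1) * (4 * a) + (4 * b + 1) by ring,
      pow_add, pow_mul, hζ.pow_eq_one, one_pow, one_mul]
  rw [e1, e2] at h
  convert h using 1
  unfold thetaRoot
  ring

theorem thetaRoot_eq_zero (hζ : IsPrimitiveRoot ζ (2 * e + 1)) {b : ℕ} (hb : e < b) :
    thetaRoot ζ b = 0 := by
  rw [thetaRoot, beta_eq_zero hζ hb]; simp

theorem sum_thetaRoot (hζ : IsPrimitiveRoot ζ (2 * e + 1)) {r : ℕ} (hr : e + 1 ≤ r) :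
    ∑ b ∈ Finset.range r, thetaRoot ζ b = 0 := by
  obtain ⟨s, rfl⟩ := Nat.exists_eq_add_of_le hr
  rw [Finset.sum_range_add, Finset.sum_eq_zero (s := Finset.range s)
    fun i _ => thetaRoot_eq_zero hζ (by omega), add_zero]
  have h := sum_eq_zero_of_reflect hζ (fun _ => (1 - ζ)⁻¹) fun _ _ => rfl
  rw [← h]
  refine Finset.sum_congr rfl fun k _ => ?_
  unfold thetaRoot
  ring

theorem spec_doubleSum (hζ : IsPrimitiveRoot ζ (2 * e + 1)) (he : 0 < e) (N : ℕ) :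
    SpecTo ζ (doubleSum ((2 * e + 1) * N)) 0 := by
  choose C hC using exists_spec_theta hζ he
  set d := 2 * e + 1 with hd
  set τ : ℕ → ℂ := fun i => C (i / d) * thetaRoot ζ (i % d) with hτ
  have hspec (i : ℕ) : SpecTo ζ (theta i) (τ i) := by
    have := hC (i / d) (i % d) (Nat.mod_lt _ (by omega))
    rwa [Nat.div_add_mod] at this
  have hval (a b : ℕ) (hb : b < d) : τ (d * a + b) = C a * thetaRoot ζ b := by
    have e1 : (d * a + b) / d = a := by
      rw [Nat.mul_add_div (by omega), Nat.div_eq_of_lt hb, add_zero]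
    simp only [hτ, e1, Nat.mul_add_mod, Nat.mod_eq_of_lt hb]
  have hpart (a r : ℕ) (hr : r ≤ d) : ∑ i ∈ Finset.range r, τ (d * a + i) =
      C a * ∑ b ∈ Finset.range r, thetaRoot ζ b := by
    rw [Finset.mul_sum]
    exact Finset.sum_congr rfl fun b hb =>
      hval a b (lt_of_lt_of_le (Finset.mem_range.mp hb) hr)
  have hfull (a : ℕ) : ∑ i ∈ Finset.range (d * a), τ i = 0 := by
    induction a with
    | zero => simp
    | succ a ih =>
      rw [mul_add, mul_one, Finset.sum_range_add, ih, hpart a d le_rfl,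
        sum_thetaRoot hζ (by omega)]
      simp
  rw [doubleSum_eq]
  have h := SpecTo.sum (Finset.range (d * N)) fun i _ =>
    (hspec i).mul (SpecTo.sum (Finset.range (d * N - i)) fun j _ => hspec j)
  convert h using 1
  symm
  refine Finset.sum_eq_zero fun i hi => ?_
  have hi := Finset.mem_range.mp hi
  -- If i % d ≤ e, the inner range consists of full blocks and a partial one of length d - i % d ≥ e
  -- + 1, which contains all nonzero values of the pattern; both sum to zero. Otherwise the value of
  -- θ(i) is zero.
  by_cases hb : i % d ≤ e
  · have h1 : i / d < N := Nat.div_lt_of_lt_mul hi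
    obtain ⟨M, hM⟩ := Nat.exists_eq_add_of_lt h1
    have h2 : d * N - i = d * M + (d - i % d) := by
      have h3 := Nat.div_add_mod i d
      have h4 : d * N = d * (i / d) + d * M + d := by rw [hM]; ring
      omega
    rw [h2, Finset.sum_range_add, hfull, hpart M _ (by omega), sum_thetaRoot hζ (by omega)]
    simp
  · rw [hτ]
    simp only
    rw [thetaRoot_eq_zero hζ (by omega)]
    simp

/-- The outer [n] vanishes at ζ. All else is regular, even when d = 2e + 1 divides t, since then 1 -
q^n compensates for 1 - q^t. -/
theorem spec_productSide (hζ : IsPrimitiveRoot ζ (2 * e + 1)) (he : 0 < e) {m : ℕ}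
    (hm : 2 * e + 1 ∣ 2 * m + 1) : SpecTo ζ (productSide (2 * m + 1)) 0 := by
  have hζ0 : ζ ≠ 0 := hζ.ne_zero (by omega)
  choose B hB using exists_spec_beta' hζ
  have h1 : SpecTo ζ (qInt (2 * m + 1)) 0 := by
    have := SpecTo.qInt hζ (by omega) (2 * m + 1)
    rwa [(hζ.pow_eq_one_iff_dvd _).mpr hm, sub_self, zero_div] at this
  have h2 (k : ℕ) := ((hB k).pow 4).mul ((SpecTo.q_self ζ).pow (2 * k))
  have h3 (t : ℕ) : ∃ z, SpecTo ζ ((1 - q ^ (2 * m + 1)) / (1 - q ^ t)) z := by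
    rcases Nat.eq_zero_or_pos t with rfl | ht
    · exact ⟨0, by simpa using SpecTo.zero ζ⟩
    · exact exists_spec_one_sub_div hζ (by omega) hm ht
  choose U hU using h3
  rw [productSide_eq]
  have h := (((h1.pow 2).mul ((((SpecTo.q_self ζ).pow m).inv (pow_ne_zero _ hζ0)).pow 2)).mul
    (SpecTo.sum (Finset.range (m + 1)) fun k _ => h2 k)).mul
      (SpecTo.sum (Finset.range (m + 1)) fun k _ => (h2 k).mul ((SpecTo.one ζ).sub
        (((SpecTo.two ζ).mul ((SpecTo.two ζ).sub ((SpecTo.q_self ζ).pow (2 * m + 1)))).mul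
          (SpecTo.sum (Finset.Icc 1 (2 * k)) fun t _ =>
            ((SpecTo.q_self ζ).pow t).mul ((hU t).pow 2)))))
  convert h using 1
  ring

theorem cyclotomic_dvd_of_aeval {d : ℕ} (hζ : IsPrimitiveRoot ζ d) (hd : 0 < d) {a : ℚ[X]}
    (ha : aeval ζ a = 0) : cyclotomic d ℚ ∣ a := by
  rw [cyclotomic_eq_minpoly_rat hζ hd]
  exact minpoly.dvd ℚ ζ ha

theorem OrdGE.cyclotomic_pow_dvd {d : ℕ} (hζ : IsPrimitiveRoot ζ d) (hd : 0 < d) {k : ℕ}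
    {x : RatFunc ℚ} (hx : OrdGE (cyclotomic d ℚ) ζ k x) : cyclotomic d ℚ ^ k ∣ x.num := by
  refine hx.pow_dvd_num (cyclotomic.irreducible_rat hd).prime ?_
  rw [cyclotomic_eq_minpoly_rat hζ hd]
  exact minpoly.aeval ℚ ζ

theorem cyclotomic_dvd_num {m d : ℕ} (hd : d ∣ 2 * m + 1) (hd1 : d ≠ 1) :
    cyclotomic d ℚ ∣ (doubleSum (2 * m + 1) - productSide (2 * m + 1)).num := by
  have hodd : Odd d := Odd.of_dvd_nat ⟨m, rfl⟩ hd
  obtain ⟨e, rfl⟩ := hodd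
  have hζ := Complex.isPrimitiveRoot_exp (2 * e + 1) (by omega)
  have he : 0 < e := by omega
  obtain ⟨N, hN⟩ := hd
  have h1 := spec_doubleSum hζ he N
  rw [← hN] at h1
  have h := h1.sub (spec_productSide hζ he ⟨N, hN⟩)
  rw [sub_zero] at h
  simpa using (h.ordGE_one (P := cyclotomic (2 * e + 1) ℚ)
    fun a ha => cyclotomic_dvd_of_aeval hζ (by omega) ha).cyclotomic_pow_dvd hζ (by omega)

end RootOfUnity

/-! ### Expansion in X₀ and the congruence modulo Φ_n^6 -/

/-- `X₀ = q ^ n + q ^ (-n) - 2`. -/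
noncomputable def shift (n : ℕ) : RatFunc ℚ := (1 - q ^ n) ^ 2 / q ^ n

/-- `q ^ s / (1 - q ^ s) ^ 2`. -/
noncomputable def sqTerm (s : ℕ) : RatFunc ℚ := q ^ s / (1 - q ^ s) ^ 2

/-- The product of the factors `1 - X₀ q ^ s / (1 - q ^ s) ^ 2` over odd `s < 2k`. -/
noncomputable def oddCorr (n k : ℕ) : RatFunc ℚ :=
  ∏ i ∈ Finset.range k, (1 - shift n * sqTerm (2 * i + 1))

/-- The product of the factors `1 - X₀ q ^ s / (1 - q ^ s) ^ 2` over odd `s < 2k`, divided by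
the product over even `s` with `0 < s ≤ 2k`. -/
noncomputable def ratioCorr (n k : ℕ) : RatFunc ℚ :=
  ∏ i ∈ Finset.range k, (1 - shift n * sqTerm (2 * i + 1)) / (1 - shift n * sqTerm (2 * i + 2))

theorem add_inv_eq_shift (n : ℕ) : q ^ n + (q ^ n)⁻¹ = 2 + shift n := by
  have h : q ^ n ≠ 0 := pow_ne_zero _ q_ne_zero
  unfold shift
  field_simp
  ring

theorem pairFactor_shift (n s : ℕ) : pairFactor q (q ^ n + (q ^ n)⁻¹) (s + 1) =
    (1 - q ^ (s + 1)) ^ 2 * (1 - shift n * sqTerm (s + 1)) := by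
  have h := one_sub_ne q_pow_ne_one s
  rw [add_inv_eq_shift, pairFactor, sqTerm, pow_mul']
  generalize q ^ (s + 1) = a at *
  field_simp
  ring

theorem pairRatio_shift (n k : ℕ) :
    pairRatio q (q ^ n + (q ^ n)⁻¹) k = beta q k ^ 2 * ratioCorr n k := by
  rw [pairRatio, beta, ratioCorr, ← Finset.prod_pow, ← Finset.prod_mul_distrib]
  refine Finset.prod_congr rfl fun i _ => ?_
  rw [pairFactor_shift, pairFactor_shift n (2 * i + 1), mul_div_mul_comm, div_pow]

theorem pairRatio_two (k : ℕ) : pairRatio q 2 k = beta q k ^ 2 := by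
  rw [pairRatio, beta, ← Finset.prod_pow]
  exact Finset.prod_congr rfl fun i _ => by rw [pairFactor_two, pairFactor_two, div_pow]

theorem oddProd_shift_div (n k : ℕ) :
    oddProd q (q ^ n + (q ^ n)⁻¹) k / evenProd q 2 k = beta q k ^ 2 * oddCorr n k := by
  rw [oddProd, evenProd, beta, oddCorr, ← Finset.prod_div_distrib, ← Finset.prod_pow,
    ← Finset.prod_mul_distrib]
  refine Finset.prod_congr rfl fun i _ => ?_
  rw [pairFactor_shift, pairFactor_two, div_pow]
  ring

/-- The combination of two terminating transformations that approximates the sum of `theta`. -/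
theorem sum_theta_combination (m : ℕ) :
    2 * (∑ k ∈ Finset.range (m + 1),
      (1 - q ^ (4 * k + 1)) * q ^ k * (beta q k ^ 6 * ratioCorr (2 * m + 1) k)) -
    ∑ k ∈ Finset.range (m + 1),
      (1 - q ^ (4 * k + 1)) * q ^ k * (beta q k ^ 6 * ratioCorr (2 * m + 1) k ^ 2) =
    (1 - q ^ (2 * m + 1)) / q ^ m * ∑ k ∈ Finset.range (m + 1), beta q k ^ 4 * q ^ (2 * k) *
      (2 * oddCorr (2 * m + 1) k - ratioCorr (2 * m + 1) k) := by
  have h1 := terminating_watson q_pow_ne_one q_ne_zero m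
    (pairFactor_two_ne_zero (x := q) q_pow_ne_one)
  have h2 := terminating_watson q_pow_ne_one q_ne_zero m
    (pairFactor_root_even_ne_zero q_pow_ne_one q_ne_zero m)
  simp only [mul_div_assoc, oddProd_shift_div, pairRatio_two] at h1
  simp only [mul_div_assoc, ← pairRatio_eq_div] at h2
  simp only [pairRatio_shift] at h1 h2
  have e1 : ∑ k ∈ Finset.range (m + 1),
      (1 - q ^ (4 * k + 1)) * q ^ k * (beta q k ^ 6 * ratioCorr (2 * m + 1) k) =
      ∑ k ∈ Finset.range (m + 1), (1 - q ^ (4 * k + 1)) * q ^ k *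
        (beta q k ^ 2 * (beta q k ^ 2 * ratioCorr (2 * m + 1) k) * beta q k ^ 2) :=
    Finset.sum_congr rfl fun k _ => by ring
  have e2 : ∑ k ∈ Finset.range (m + 1),
      (1 - q ^ (4 * k + 1)) * q ^ k * (beta q k ^ 6 * ratioCorr (2 * m + 1) k ^ 2) =
      ∑ k ∈ Finset.range (m + 1), (1 - q ^ (4 * k + 1)) * q ^ k *
        (beta q k ^ 2 * (beta q k ^ 2 * ratioCorr (2 * m + 1) k) *
          (beta q k ^ 2 * ratioCorr (2 * m + 1) k)) :=
    Finset.sum_congr rfl fun k _ => by ring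
  rw [e1, e2, h1, h2, mul_left_comm, ← mul_sub, Finset.mul_sum,
    ← Finset.sum_sub_distrib]
  congr 1
  exact Finset.sum_congr rfl fun k _ => by ring

section RootOfUnity

variable {ζ : ℂ} {m : ℕ}

theorem ordGE_one_sub (hζ : IsPrimitiveRoot ζ (2 * m + 1)) :
    OrdGE (cyclotomic (2 * m + 1) ℚ) ζ 1 (1 - q ^ (2 * m + 1)) := by
  have h := SpecTo.one_sub_q_pow ζ (2 * m + 1)
  rw [hζ.pow_eq_one, sub_self] at h
  exact h.ordGE_one fun a ha => cyclotomic_dvd_of_aeval hζ (by omega) ha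

theorem spec_inv_q_pow (hζ : IsPrimitiveRoot ζ (2 * m + 1)) (k : ℕ) :
    SpecTo ζ (q ^ k)⁻¹ (ζ ^ k)⁻¹ :=
  ((SpecTo.q_self ζ).pow k).inv (pow_ne_zero _ (hζ.ne_zero (by omega)))

theorem ordGE_shift (hζ : IsPrimitiveRoot ζ (2 * m + 1)) :
    OrdGE (cyclotomic (2 * m + 1) ℚ) ζ 2 (shift (2 * m + 1)) := by
  rw [shift, div_eq_mul_inv]
  exact ((ordGE_one_sub hζ).pow 2).mul_spec (spec_inv_q_pow hζ _)

theorem spec_sqTerm (hζ : IsPrimitiveRoot ζ (2 * m + 1)) {s : ℕ} (hs : ¬ 2 * m + 1 ∣ s) :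
    SpecTo ζ (sqTerm s) (ζ ^ s / (1 - ζ ^ s) ^ 2) :=
  ((SpecTo.q_self ζ).pow s).div ((SpecTo.one_sub_q_pow ζ s).pow 2)
    (pow_ne_zero _ (one_sub_pow_ne_zero hζ hs))

theorem spec_shift (hζ : IsPrimitiveRoot ζ (2 * m + 1)) :
    SpecTo ζ (shift (2 * m + 1)) 0 := by
  have h := SpecTo.one_sub_q_pow ζ (2 * m + 1)
  rw [hζ.pow_eq_one, sub_self] at h
  rw [shift, div_eq_mul_inv]
  simpa using (h.pow 2).mul (spec_inv_q_pow hζ (2 * m + 1))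

theorem spec_altSum (hζ : IsPrimitiveRoot ζ (2 * m + 1)) {k : ℕ} (hk : k ≤ m) :
    SpecTo ζ (altSum q k) (altSum ζ k) :=
  SpecTo.sum _ fun i hi => by
    have hi := Finset.mem_range.mp hi
    exact (spec_sqTerm hζ (not_dvd_even (by omega))).sub
      (spec_sqTerm hζ (not_dvd_odd (by omega) (by omega)))

/-- First-order expansion of `oddCorr`. -/
theorem ordGE_oddCorr (hζ : IsPrimitiveRoot ζ (2 * m + 1)) {k : ℕ} (hk : k ≤ m) :
    OrdGE (cyclotomic (2 * m + 1) ℚ) ζ 4 (oddCorr (2 * m + 1) k -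
      (1 - shift (2 * m + 1) * ∑ i ∈ Finset.range k, sqTerm (2 * i + 1))) := by
  induction k with
  | zero => simpa [oddCorr] using OrdGE.zero _ ζ 4
  | succ k ih =>
    have h1 := ih (by omega)
    have hu := spec_sqTerm hζ (not_dvd_odd (e := m) (i := k) (by omega) (by omega))
    have hX := ordGE_shift hζ
    have hs := SpecTo.sum (Finset.range k) fun i hi => spec_sqTerm hζ
      (not_dvd_odd (e := m) (i := i) (by have := Finset.mem_range.mp hi; omega)
        (by have := Finset.mem_range.mp hi; omega))
    have h2 := (h1.mul_spec ((SpecTo.one ζ).sub ((spec_shift hζ).mul hu))).add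
      ((hX.mul hX).mul_spec (hs.mul hu))
    rw [Finset.sum_range_succ, oddCorr, Finset.prod_range_succ, ← oddCorr]
    convert h2 using 1
    ring

/-- First-order expansion of `ratioCorr`. -/
theorem ordGE_ratioCorr (hζ : IsPrimitiveRoot ζ (2 * m + 1)) {k : ℕ} (hk : k ≤ m) :
    OrdGE (cyclotomic (2 * m + 1) ℚ) ζ 4 (ratioCorr (2 * m + 1) k -
      (1 + shift (2 * m + 1) * altSum q k)) := by
  induction k with
  | zero => simpa [ratioCorr, altSum] using OrdGE.zero _ ζ 4
  | succ k ih =>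
    have h1 := ih (by omega)
    have hu := spec_sqTerm hζ (not_dvd_odd (e := m) (i := k) (by omega) (by omega))
    have hv := spec_sqTerm hζ (not_dvd_even (e := m) (i := k) (by omega))
    have hX := ordGE_shift hζ
    have hs := spec_altSum hζ (k := k) (by omega)
    have hd : SpecTo ζ (1 - shift (2 * m + 1) * sqTerm (2 * k + 2))⁻¹ 1 := by
      have h := ((SpecTo.one ζ).sub ((spec_shift hζ).mul hv)).inv (by simp)
      simpa using h
    have hd0 : 1 - shift (2 * m + 1) * sqTerm (2 * k + 2) ≠ 0 := by
      have h := pairFactor_root_even_ne_zero q_pow_ne_one q_ne_zero m k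
      rw [pairFactor_shift _ (2 * k + 1)] at h
      exact right_ne_zero_of_mul h
    have h2 := (h1.mul_spec (((SpecTo.one ζ).sub ((spec_shift hζ).mul hu)).mul hd)).add
      (((hX.mul hX).mul_spec (hs.mul (hv.sub hu))).add
        ((hX.mul hX).mul_spec (((SpecTo.one ζ).add ((spec_shift hζ).mul hs)).mul
          ((hv.mul (hv.sub hu)).mul hd))))
    have e1 : altSum q (k + 1) = altSum q k + (sqTerm (2 * k + 2) - sqTerm (2 * k + 1)) :=
      Finset.sum_range_succ _ _
    rw [e1, ratioCorr, Finset.prod_range_succ, ← ratioCorr]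
    convert h2 using 1
    field_simp
    ring

theorem sum_Icc_eq (f : ℕ → RatFunc ℚ) (k : ℕ) : ∑ t ∈ Finset.Icc 1 (2 * k), f t =
    ∑ i ∈ Finset.range k, (f (2 * i + 1) + f (2 * i + 2)) := by
  induction k with
  | zero => simp
  | succ k ih =>
    rw [mul_add, mul_one, Finset.sum_Icc_succ_top (by omega), Finset.sum_Icc_succ_top (by omega),
      ih, Finset.sum_range_succ, add_assoc]

theorem spec_sum_sqTerm (hζ : IsPrimitiveRoot ζ (2 * m + 1)) {k : ℕ} (hk : k ≤ m) :
    ∃ z, SpecTo ζ (∑ t ∈ Finset.Icc 1 (2 * k), sqTerm t) z :=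
  ⟨_, SpecTo.sum _ fun t ht => spec_sqTerm hζ fun h => by
    have := Finset.mem_Icc.mp ht
    have := Nat.le_of_dvd (by omega) h
    omega⟩

/-- To first order in X₀, twice minus the odd sum, less (even sum minus odd sum), is minus the sum
over all t ≤ 2k. -/
theorem ordGE_combination (hζ : IsPrimitiveRoot ζ (2 * m + 1)) {k : ℕ} (hk : k ≤ m) :
    OrdGE (cyclotomic (2 * m + 1) ℚ) ζ 4 (2 * oddCorr (2 * m + 1) k - ratioCorr (2 * m + 1) k -
      (1 - shift (2 * m + 1) * ∑ t ∈ Finset.Icc 1 (2 * k), sqTerm t)) := by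
  have h1 := ordGE_oddCorr hζ hk
  have h := (h1.add h1).sub (ordGE_ratioCorr hζ hk)
  have e : altSum q k = ∑ i ∈ Finset.range k, sqTerm (2 * i + 2) -
      ∑ i ∈ Finset.range k, sqTerm (2 * i + 1) := Finset.sum_sub_distrib _ _
  rw [e] at h
  rw [sum_Icc_eq, Finset.sum_add_distrib]
  convert h using 1
  ring

/-- The second difference of the deformed sum vanishes to order five. -/
theorem ordGE_second_difference (hζ : IsPrimitiveRoot ζ (2 * m + 1)) :
    OrdGE (cyclotomic (2 * m + 1) ℚ) ζ 5 (∑ k ∈ Finset.range (m + 1),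
      (1 - q ^ (4 * k + 1)) * q ^ k * (beta q k ^ 6 * (ratioCorr (2 * m + 1) k - 1) ^ 2)) := by
  have hX := ordGE_shift hζ
  have hc (k : ℕ) (hk : k ≤ m) := (((SpecTo.one_sub_q_pow ζ (4 * k + 1)).mul
    ((spec_beta hζ (b := k) (by omega)).pow 6)).mul ((SpecTo.q_self ζ).pow k))
  have h1 := SpecTo.sum (Finset.range (m + 1)) fun k hk =>
    (hc k (Nat.le_of_lt_succ (Finset.mem_range.mp hk))).mul
      ((spec_altSum hζ (Nat.le_of_lt_succ (Finset.mem_range.mp hk))).pow 2)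
  rw [sum_eq_zero_of_reflect hζ (fun k => altSum ζ k ^ 2)
    fun k hk => by rw [altSum_reflect hζ hk]] at h1
  have h2 := (hX.pow 2).mul (h1.ordGE_one (P := cyclotomic (2 * m + 1) ℚ)
    fun a ha => cyclotomic_dvd_of_aeval hζ (by omega) ha)
  -- The error in replacing R_k - 1 by X₀ times `altSum q k` in the square is a difference of
  -- squares, of order at least 4 + 2.
  have h3 := OrdGE.sum (P := cyclotomic (2 * m + 1) ℚ) (ζ := ζ) (e := 5) (Finset.range (m + 1))
    (f := fun k => (ratioCorr (2 * m + 1) k - (1 + shift (2 * m + 1) * altSum q k)) *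
      (ratioCorr (2 * m + 1) k - (1 + shift (2 * m + 1) * altSum q k) +
        shift (2 * m + 1) * (altSum q k + altSum q k)) *
      ((1 - q ^ (4 * k + 1)) * beta q k ^ 6 * q ^ k)) fun k hk => by
    have hk := Nat.le_of_lt_succ (Finset.mem_range.mp hk)
    have h4 := ordGE_ratioCorr hζ hk
    have hs := spec_altSum hζ hk
    exact ((h4.mul ((h4.mono (by omega)).add (hX.mul_spec (hs.add hs)))).mul_spec
      (hc k hk)).mono (by omega)
  convert h2.add h3 using 1
  rw [Finset.mul_sum, ← Finset.sum_add_distrib]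
  exact Finset.sum_congr rfl fun k _ => by ring

/-- The sum of `theta` modulo the fifth power of the cyclotomic polynomial. -/
theorem ordGE_sum_theta (hζ : IsPrimitiveRoot ζ (2 * m + 1)) (hm : 0 < m) :
    OrdGE (cyclotomic (2 * m + 1) ℚ) ζ 5 (∑ k ∈ Finset.range (m + 1), theta k -
      qInt (2 * m + 1) * (q ^ m)⁻¹ * ∑ k ∈ Finset.range (m + 1), beta q k ^ 4 * q ^ (2 * k) *
        (1 - shift (2 * m + 1) * ∑ t ∈ Finset.Icc 1 (2 * k), sqTerm t)) := by
  have h1 := ordGE_second_difference hζ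
  have h2 := OrdGE.sum (P := cyclotomic (2 * m + 1) ℚ) (ζ := ζ) (e := 4) (Finset.range (m + 1))
    (f := fun k => (2 * oddCorr (2 * m + 1) k - ratioCorr (2 * m + 1) k -
      (1 - shift (2 * m + 1) * ∑ t ∈ Finset.Icc 1 (2 * k), sqTerm t)) *
        (beta q k ^ 4 * q ^ (2 * k))) fun k hk => by
    have hk := Nat.le_of_lt_succ (Finset.mem_range.mp hk)
    exact (ordGE_combination hζ hk).mul_spec
      (((spec_beta hζ (b := k) (by omega)).pow 4).mul ((SpecTo.q_self ζ).pow (2 * k)))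
  have h3 := ((ordGE_one_sub hζ).mul h2).mul_spec (spec_inv_q_pow hζ m)
  have hq : SpecTo ζ (1 - q)⁻¹ (1 - ζ)⁻¹ := by
    have := one_sub_pow_ne_zero hζ (k := 1) (by rw [Nat.dvd_one]; omega)
    rw [pow_one] at this
    exact ((SpecTo.one ζ).sub (SpecTo.q_self ζ)).inv this
  convert ((h1.add h3).mul_spec hq) using 1
  have e1 : ∑ k ∈ Finset.range (m + 1), theta k = (∑ k ∈ Finset.range (m + 1),
      (1 - q ^ (4 * k + 1)) * q ^ k * beta q k ^ 6) * (1 - q)⁻¹ := by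
    rw [Finset.sum_mul]
    refine Finset.sum_congr rfl fun k _ => ?_
    rw [theta_eq, qInt]
    ring
  have e2 : ∑ k ∈ Finset.range (m + 1), (1 - q ^ (4 * k + 1)) * q ^ k *
      (beta q k ^ 6 * (ratioCorr (2 * m + 1) k - 1) ^ 2) =
      ∑ k ∈ Finset.range (m + 1), (1 - q ^ (4 * k + 1)) * q ^ k * beta q k ^ 6 -
      (2 * (∑ k ∈ Finset.range (m + 1),
      (1 - q ^ (4 * k + 1)) * q ^ k * (beta q k ^ 6 * ratioCorr (2 * m + 1) k)) -
      ∑ k ∈ Finset.range (m + 1),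
      (1 - q ^ (4 * k + 1)) * q ^ k * (beta q k ^ 6 * ratioCorr (2 * m + 1) k ^ 2)) := by
    rw [Finset.mul_sum, ← Finset.sum_sub_distrib, ← Finset.sum_sub_distrib]
    exact Finset.sum_congr rfl fun k _ => by ring
  have e3 : ∑ k ∈ Finset.range (m + 1), (2 * oddCorr (2 * m + 1) k - ratioCorr (2 * m + 1) k -
      (1 - shift (2 * m + 1) * ∑ t ∈ Finset.Icc 1 (2 * k), sqTerm t)) *
        (beta q k ^ 4 * q ^ (2 * k)) = ∑ k ∈ Finset.range (m + 1), beta q k ^ 4 * q ^ (2 * k) *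
      (2 * oddCorr (2 * m + 1) k - ratioCorr (2 * m + 1) k) -
      ∑ k ∈ Finset.range (m + 1), beta q k ^ 4 * q ^ (2 * k) *
        (1 - shift (2 * m + 1) * ∑ t ∈ Finset.Icc 1 (2 * k), sqTerm t) := by
    rw [← Finset.sum_sub_distrib]
    exact Finset.sum_congr rfl fun k _ => by ring
  rw [e1, e2, e3, sum_theta_combination, qInt]
  ring

theorem spec_theta (hζ : IsPrimitiveRoot ζ (2 * m + 1)) (hm : 0 < m) {k : ℕ}
    (hk : k < 2 * m + 1) : ∃ z, SpecTo ζ (theta k) z := by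
  rw [theta_eq]
  exact ⟨_, ((SpecTo.qInt hζ (by omega) _).mul ((spec_beta hζ hk).pow 6)).mul
    ((SpecTo.q_self ζ).pow k)⟩

theorem ordGE_theta (hζ : IsPrimitiveRoot ζ (2 * m + 1)) (hm : 0 < m) {k : ℕ} (hmk : m < k)
    (hk : k < 2 * m + 1) : OrdGE (cyclotomic (2 * m + 1) ℚ) ζ 6 (theta k) := by
  have h1 := spec_beta hζ hk
  rw [beta_eq_zero hζ hmk] at h1
  have h2 := (h1.ordGE_one (P := cyclotomic (2 * m + 1) ℚ)
    fun a ha => cyclotomic_dvd_of_aeval hζ (by omega) ha).pow 6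
  rw [theta_eq]
  convert h2.mul_spec ((SpecTo.qInt hζ (by omega) (4 * k + 1)).mul ((SpecTo.q_self ζ).pow k))
    using 1
  ring

/-- All pairs with i, j ≤ m satisfy i + j ≤ 2m = n - 1. Any other pair has an index strictly between
m and n, whose θ has order 6. -/
theorem ordGE_doubleSum_sub_sq (hζ : IsPrimitiveRoot ζ (2 * m + 1)) (hm : 0 < m) :
    OrdGE (cyclotomic (2 * m + 1) ℚ) ζ 6
      (doubleSum (2 * m + 1) - (∑ k ∈ Finset.range (m + 1), theta k) ^ 2) := by
  have hT (r : ℕ) (hr : r ≤ m) : OrdGE (cyclotomic (2 * m + 1) ℚ) ζ 6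
      (∑ j ∈ Finset.range r, theta (m + 1 + j)) :=
    OrdGE.sum _ fun j hj => ordGE_theta hζ hm (by omega)
      (by have := Finset.mem_range.mp hj; omega)
  have h1 := OrdGE.sum (P := cyclotomic (2 * m + 1) ℚ) (ζ := ζ) (e := 6) (Finset.range (m + 1))
    (f := fun i => (∑ j ∈ Finset.range (m - i), theta (m + 1 + j)) * theta i) fun i hi => by
    obtain ⟨z, hz⟩ := spec_theta hζ hm (k := i) (by have := Finset.mem_range.mp hi; omega)
    exact (hT (m - i) (by omega)).mul_spec hz
  have h2 := OrdGE.sum (P := cyclotomic (2 * m + 1) ℚ) (ζ := ζ) (e := 6) (Finset.range m)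
    (f := fun i => theta (m + 1 + i) *
      ∑ j ∈ Finset.range (2 * m + 1 - (m + 1 + i)), theta j) fun i hi => by
    have hi := Finset.mem_range.mp hi
    have h3 : OrdGE (cyclotomic (2 * m + 1) ℚ) ζ 0
        (∑ j ∈ Finset.range (2 * m + 1 - (m + 1 + i)), theta j) := OrdGE.sum _ fun j hj => by
      obtain ⟨z, hz⟩ := spec_theta hζ hm (k := j) (by have := Finset.mem_range.mp hj; omega)
      exact hz.ordGE_zero
    exact (ordGE_theta hζ hm (by omega) (by omega)).mul h3
  convert h1.add h2 using 1
  rw [doubleSum_eq, show 2 * m + 1 = m + 1 + m by ring, Finset.sum_range_add, add_sub_right_comm]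
  congr 1
  rw [sq, Finset.sum_mul, ← Finset.sum_sub_distrib]
  refine Finset.sum_congr rfl fun i hi => ?_
  have hi := Finset.mem_range.mp hi
  rw [show m + 1 + m - i = m + 1 + (m - i) by omega, Finset.sum_range_add]
  ring

theorem ordGE_difference (hζ : IsPrimitiveRoot ζ (2 * m + 1)) (hm : 0 < m) :
    OrdGE (cyclotomic (2 * m + 1) ℚ) ζ 6 (doubleSum (2 * m + 1) - productSide (2 * m + 1)) := by
  set A := ∑ k ∈ Finset.range (m + 1), beta q k ^ 4 * q ^ (2 * k) with hA
  set B := ∑ k ∈ Finset.range (m + 1), beta q k ^ 4 * q ^ (2 * k) *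
    ∑ t ∈ Finset.Icc 1 (2 * k), sqTerm t with hB
  set S := ∑ k ∈ Finset.range (m + 1), theta k with hS
  have hβ (k : ℕ) (hk : k ∈ Finset.range (m + 1)) := ((spec_beta hζ (b := k)
    (by have := Finset.mem_range.mp hk; omega)).pow 4).mul ((SpecTo.q_self ζ).pow (2 * k))
  have hA0 := SpecTo.sum _ hβ
  have hB0 : OrdGE (cyclotomic (2 * m + 1) ℚ) ζ 0 B := OrdGE.sum _ fun k hk => by
    obtain ⟨z, hz⟩ := spec_sum_sqTerm hζ (k := k) (by have := Finset.mem_range.mp hk; omega)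
    exact ((hβ k hk).mul hz).ordGE_zero
  obtain ⟨b, hb⟩ := hB0.exists_spec
  have hq : SpecTo ζ (1 - q)⁻¹ (1 - ζ)⁻¹ := by
    have := one_sub_pow_ne_zero hζ (k := 1) (by rw [Nat.dvd_one]; omega)
    rw [pow_one] at this
    exact ((SpecTo.one ζ).sub (SpecTo.q_self ζ)).inv this
  have hε := ordGE_one_sub hζ
  have hX := ordGE_shift hζ
  have hn : OrdGE (cyclotomic (2 * m + 1) ℚ) ζ 1 (qInt (2 * m + 1) * (q ^ m)⁻¹) := by
    rw [qInt, div_eq_mul_inv]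
    exact (hε.mul_spec hq).mul_spec (spec_inv_q_pow hζ m)
  have h1 := ordGE_sum_theta hζ hm
  have e1 : ∑ k ∈ Finset.range (m + 1), beta q k ^ 4 * q ^ (2 * k) *
      (1 - shift (2 * m + 1) * ∑ t ∈ Finset.Icc 1 (2 * k), sqTerm t) =
      A - shift (2 * m + 1) * B := by
    rw [hA, hB, Finset.mul_sum, ← Finset.sum_sub_distrib]
    exact Finset.sum_congr rfl fun k _ => by ring
  rw [e1, ← hS] at h1
  set V := qInt (2 * m + 1) * (q ^ m)⁻¹ * (A - shift (2 * m + 1) * B) with hV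
  have hV1 : OrdGE (cyclotomic (2 * m + 1) ℚ) ζ 1 V :=
    hn.mul_spec (hA0.sub ((spec_shift hζ).mul hb))
  -- S² - V² factors with orders at least 5 and 1.
  have h2 : OrdGE (cyclotomic (2 * m + 1) ℚ) ζ 6 ((S - V) * (S - V + (V + V))) :=
    h1.mul ((h1.mono (by omega)).add (hV1.add hV1))
  have e2 : productSide (2 * m + 1) = (qInt (2 * m + 1) * (q ^ m)⁻¹) ^ 2 * A *
      (A - 2 * (2 - q ^ (2 * m + 1)) * (1 - q ^ (2 * m + 1)) ^ 2 * B) := by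
    rw [productSide_eq, ← hA, hB, mul_pow]
    congr 1
    rw [hA, Finset.mul_sum, ← Finset.sum_sub_distrib]
    refine Finset.sum_congr rfl fun k _ => ?_
    have e3 : ∑ t ∈ Finset.Icc 1 (2 * k), q ^ t * ((1 - q ^ (2 * m + 1)) / (1 - q ^ t)) ^ 2 =
        (1 - q ^ (2 * m + 1)) ^ 2 * ∑ t ∈ Finset.Icc 1 (2 * k), sqTerm t := by
      rw [Finset.mul_sum]
      refine Finset.sum_congr rfl fun t _ => ?_
      rw [sqTerm, div_pow]
      ring
    rw [e3]
    ring
  have h3 : OrdGE (cyclotomic (2 * m + 1) ℚ) ζ 6 ((qInt (2 * m + 1) * (q ^ m)⁻¹) ^ 2 *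
      (shift (2 * m + 1) * shift (2 * m + 1)) * (B * B)) :=
    ((hn.pow 2).mul (hX.mul hX)).mul_spec (hb.mul hb)
  have h4 : OrdGE (cyclotomic (2 * m + 1) ℚ) ζ 6 ((qInt (2 * m + 1) * (q ^ m)⁻¹) ^ 2 *
      ((1 - q ^ (2 * m + 1)) ^ 2 * shift (2 * m + 1)) * (A * (B + B))) :=
    ((hn.pow 2).mul ((hε.pow 2).mul hX)).mul_spec (hA0.mul (hb.add hb))
  convert (ordGE_doubleSum_sub_sq hζ hm).add (h2.add (h3.sub h4)) using 1
  -- X₀/(1 - q^n)² is q^(-n) = 2 - q^n + X₀. The stated coefficient 2 - q^n therefore differs from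
  -- the exact one by X₀, a change of order 6 once [n]² and (1 - q^n)² are counted.
  have e4 : shift (2 * m + 1) =
      (1 - q ^ (2 * m + 1)) ^ 2 * (2 - q ^ (2 * m + 1) + shift (2 * m + 1)) := by
    have h : q ^ (2 * m + 1) ≠ 0 := pow_ne_zero _ q_ne_zero
    rw [shift]
    generalize q ^ (2 * m + 1) = a at *
    field_simp
    ring
  rw [e2, ← hS, hV]
  linear_combination (-2 * (qInt (2 * m + 1) * (q ^ m)⁻¹) ^ 2 * A * B) * e4

end RootOfUnity

/-! ### Assembling the cyclotomic factors -/

theorem modulus_dvd {m : ℕ} (hm : 0 < m) {a : ℚ[X]}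
    (h1 : cyclotomic (2 * m + 1) ℚ ^ 6 ∣ a)
    (h2 : ∀ d, d ∣ 2 * m + 1 → d ≠ 1 → cyclotomic d ℚ ∣ a) :
    qIntPoly (2 * m + 1) * cyclotomic (2 * m + 1) ℚ ^ 5 ∣ a := by
  have hmem : 2 * m + 1 ∈ (2 * m + 1).divisors.erase 1 := by
    simp only [Finset.mem_erase, Nat.mem_divisors, dvd_refl, true_and]
    omega
  have e : qIntPoly (2 * m + 1) * cyclotomic (2 * m + 1) ℚ ^ 5 =
      cyclotomic (2 * m + 1) ℚ ^ 6 *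
        ∏ d ∈ ((2 * m + 1).divisors.erase 1).erase (2 * m + 1), cyclotomic d ℚ := by
    rw [qIntPoly, ← prod_cyclotomic_eq_geom_sum (by omega), ← Finset.mul_prod_erase _ _ hmem]
    ring
  rw [e]
  refine IsCoprime.mul_dvd ?_ h1 ?_
  · refine IsCoprime.prod_right fun d hd => IsCoprime.pow_left ?_
    exact cyclotomic.isCoprime_rat (Finset.ne_of_mem_erase hd).symm
  · refine Finset.prod_dvd_of_coprime (fun i _ j _ hij => cyclotomic.isCoprime_rat hij)
      fun d hd => ?_
    have h3 := Finset.mem_of_mem_erase hd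
    exact h2 d (Nat.dvd_of_mem_divisors (Finset.mem_of_mem_erase h3)) (Finset.ne_of_mem_erase h3)

theorem doubleSum_one : doubleSum 1 = productSide 1 := by
  have h := productSide_eq 0
  simp only [mul_zero, zero_add] at h
  rw [h, doubleSum_eq]
  have h1 : qInt 1 = 1 := by simp [qInt, one_sub_q_ne_zero]
  simp [h1, theta_eq, beta]

end QSuper

theorem mainTheorem2 (n : ℕ) (hn : Odd n) :
    QSuper.RatModEq (QSuper.qIntPoly n * Polynomial.cyclotomic n ℚ ^ 5)
      (∑ p ∈ (Finset.range n ×ˢ Finset.range n).filter (fun p => p.1 + p.2 ≤ n - 1),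
        QSuper.theta p.1 * QSuper.theta p.2)
      (QSuper.qInt n ^ 2 * QSuper.q ^ (1 - (n : ℤ)) *
        (∑ k ∈ Finset.range ((n - 1) / 2 + 1), QSuper.term k) *
        ∑ k ∈ Finset.range ((n - 1) / 2 + 1), QSuper.term k *
          (1 - 2 * (2 - QSuper.q ^ n) * QSuper.qInt n ^ 2 *
            ∑ t ∈ Finset.Icc 1 (2 * k), QSuper.q ^ t / QSuper.qInt t ^ 2)) := by
  change QSuper.qIntPoly n * Polynomial.cyclotomic n ℚ ^ 5 ∣
    (QSuper.doubleSum n - QSuper.productSide n).num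
  obtain ⟨m, rfl⟩ := hn
  -- For n = 1 the factor Φ_1^5 is not covered by roots of unity of order d ≠ 1, but the two sides
  -- are equal.
  rcases Nat.eq_zero_or_pos m with rfl | hm
  · rw [mul_zero, zero_add, QSuper.doubleSum_one, sub_self, RatFunc.num_zero]
    exact dvd_zero _
  · have hζ := Complex.isPrimitiveRoot_exp (2 * m + 1) (by omega)
    exact QSuper.modulus_dvd hm
      ((QSuper.ordGE_difference hζ hm).cyclotomic_pow_dvd hζ (by omega))
      fun d hd hd1 => QSuper.cyclotomic_dvd_num hd hd1
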